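/- **Setting.** Let $p\ge 0$, $k\ge 1$, $L\ge 1$, $r\in\{0,\dots,p\}$. A VAR($k$) model $f_0(z_t)=c+\sum_{i=1}^k f_i(z_{t-i})+u_t$ is parametrised by $c\in\mathbb R^p$ and maps $f_i:\mathbb R^p\to\mathbb R^p$ ($0\le i\le k$). Put $\pi(z)=-f_0(z)+\sum_{i=1}^k f_i(z)$ and $g_j(z)=-\sum_{i=j+1}^k f_i(z)$. Matrix norms are those induced by the Euclidean norm, and for a set $\mathcal A$ of real square matrices $\rho_{\mathrm{JSR}}(\mathcal A)=\limsup_{t\to\infty}\sup_{B\in\mathcal A^t}\rho(B)^{1/t}$, where $\mathcal A^t$ is the set of $t$-fold products and $\rho(B)$ is the spectral radius. Let $D\in\mathbb R^{p(k-1)\times p(k-1)}$ be the block matrix with $-I_p$ on the diagonal and $I_p$ on the superdiagonal (empty if $k=1$), $E\in\mathbb R^{p(k-1)\times p}$ the matrix with first block $I_p$ and other blocks $0$, and $$D_0=\begin{bmatrix}0_{r\times p}&0\\0&D\end{bmatrix},\qquad \boldsymbol\alpha=\begin{bmatrix}\alpha&E^{\mathsf T}\\0&I_{p(k-1)}\end{bmatrix}\quad(\alpha\in\mathbb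 R^{p\times r}).$$ **The class $\mathcal M_r(\alpha,\bar b,\bar\rho)$.** For $\operatorname{rank}\alpha=r$, $\bar b\in\mathbb R$, $\bar\rho\in[0,1)$, the model $(c,\{f_i\}_{i=0}^k)$ belongs to $\mathcal M_r(\alpha,\bar b,\bar\rho)$ if (i) $f_0$ is a homeomorphism of $\mathbb R^p$; (ii) there are $\mu\in\mathbb R^r$ and $\theta:\mathbb R^p\to\mathbb R^r$ with $c=\alpha\mu$ and $\pi(z)=\alpha\theta(z)$ for all $z$; and (iii) with $\boldsymbol\theta=(\theta,g_1,\dots,g_{k-1})$ (stacked), there is a closed set $\mathcal B\subset\mathbb R^{pk\times[p(k-1)+r]}$ with $\|\boldsymbol\beta\|\le\bar b$ for all $\boldsymbol\beta\in\mathcal B$ and $\rho_{\mathrm{JSR}}(\{I+\boldsymbol\beta^{\mathsf T}\boldsymbol\alpha:\boldsymbol\beta\in\mathcal B\})\le\bar\rho$, such that for all $\boldsymbol z=(z,\zeta)$, $\boldsymbol z'=(z',\zeta')$ in $\mathbb R^p\times\mathbb R^{p(k-1)}$ there is $\boldsymbol\beta\in\mathcal B$ with $$[\boldsymbol\theta(f_0^{-1}(z))+D_0\boldsymbol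 z]-[\boldsymbol\theta(f_0^{-1}(z'))+D_0\boldsymbol z'] =\boldsymbol\beta^{\mathsf T}(\boldsymbol z-\boldsymbol z').$$ **Piecewise affine VARs.** Suppose $f_i(z)=\sum_{\ell=1}^L\mathbf 1\{z\in Z^{(\ell)}\}(\bar\phi_i^{(\ell)}+\Phi_i^{(\ell)}z)$ is continuous for each $i\in\{0,\dots,k\}$, where $Z^{(1)},\dots,Z^{(L)}$ are convex and partition $\mathbb R^p$ (a *piecewise affine VAR*). It is *piecewise linear* if all $\bar\phi_i^{(\ell)}=0$ and there is a basis $a_1,\dots,a_p$ of $\mathbb R^p$ such that each $Z^{(\ell)}$ is a union of cones of the form $\{z:a_i^{\mathsf T}z\ge0\ \forall i\in I,\ a_i^{\mathsf T}z<0\ \forall i\notin I\}$, $I\subset\{1,\dots,p\}$. It is *threshold affine* if there are $a\in\mathbb R^p\setminus\{0\}$ and $-\infty=\tau_0<\tau_1<\dots<\tau_L=+\infty$ with $Z^{(\ell)}=\{z:a^{\mathsf T}z\in(\tau_{\ell-1},\tau_\ell]\}$. Write $\bar\pi^{(\ell)}=-\bar\phi_0^{(\ell)}+\sum_{i=1}^k\bar\phi_i^{(\ell)}$,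 $\Pi^{(\ell)}=-\Phi_0^{(\ell)}+\sum_{i=1}^k\Phi_i^{(\ell)}$, $\bar\gamma_j^{(\ell)}=-\sum_{i=j+1}^k\bar\phi_i^{(\ell)}$, $\Gamma_j^{(\ell)}=-\sum_{i=j+1}^k\Phi_i^{(\ell)}$, let $\boldsymbol\Gamma^{(\ell)}$ be the stack of $\Gamma_1^{(\ell)},\dots,\Gamma_{k-1}^{(\ell)}$, and, for given $\beta^{(\ell)}\in\mathbb R^{p\times r}$, $$\boldsymbol\beta^{(\ell)\mathsf T}=\begin{bmatrix}\beta^{(\ell)\mathsf T}(\Phi_0^{(\ell)})^{-1}&0\\ \boldsymbol\Gamma^{(\ell)}(\Phi_0^{(\ell)})^{-1}&D\end{bmatrix}$$ (if $\Phi_0^{(\ell)}$ is singular, which below can only happen when $Z^{(\ell)}$ has empty interior, read $(\Phi_0^{(\ell)})^{-1}$ as $0$). **Proposition.** Suppose $(c,\{f_i\}_{i=0}^k)$ is a piecewise affine VAR, $\bar\rho\in[0,1)$, and 1. either the model is piecewise linear or threshold affine and $\operatorname{sgn}\det\Phi_0^{(\ell)}=\operatorname{sgn}\det\Phi_0^{(1)}\ne0$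 for all $\ell$; or $f_0$ is a homeomorphism; 2. $c=\alpha\mu$, $\bar\pi^{(\ell)}=\alpha\bar\mu^{(\ell)}$ and $\Pi^{(\ell)}=\alpha\beta^{(\ell)\mathsf T}$ for all $\ell$, where $\mu,\bar\mu^{(\ell)}\in\mathbb R^r$ and $\alpha,\beta^{(\ell)}\in\mathbb R^{p\times r}$ have rank $r$; 3. $\rho_{\mathrm{JSR}}(\{I_{p(k-1)+r}+\boldsymbol\beta^{(\ell)\mathsf T}\boldsymbol\alpha\}_{\ell=1}^L)\le\bar\rho$. Then $(c,\{f_i\}_{i=0}^k)$ belongs to $\mathcal M_r(\alpha,\bar b,\bar\rho)$ for every $\bar b\ge\max_\ell\|\boldsymbol\beta^{(\ell)}\|$. Moreover, for the (unique) $\theta$ with $\pi=\alpha\theta$ and for any $\alpha_\perp\in\mathbb R^{p\times(p-r)}$ with $\operatorname{rank}\alpha_\perp=p-r$ and $\alpha_\perp^{\mathsf T}\alpha=0$, the map $\chi(z)=\begin{bmatrix}\alpha_\perp^{\mathsf T}[f_0(z)-\sum_{j=1}^{k-1}g_j(z)]\\\theta(z)\end{bmatrix}$ satisfies, for all $z\in\mathbb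 R^p$, $$\chi(z)=\sum_{\ell=1}^L\mathbf 1\{z\in Z^{(\ell)}\}\left\{ \begin{bmatrix}\alpha_\perp^{\mathsf T}\bigl(\bar\phi_0^{(\ell)}-\sum_{j=1}^{k-1}\bar\gamma_j^{(\ell)}\bigr)\\\bar\mu^{(\ell)}\end{bmatrix} +\begin{bmatrix}\alpha_\perp^{\mathsf T}\bigl(\Phi_0^{(\ell)}-\sum_{j=1}^{k-1}\Gamma_j^{(\ell)}\bigr)\\\beta^{(\ell)\mathsf T}\end{bmatrix}z\right\}.$$ -/

import Mathlib

open Filter Topology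

noncomputable section

namespace NonlinearVAR

section Norms

open scoped Matrix.Norms.L2Operator

/-- The matrix norm induced by the Euclidean vector norms. -/
def matNorm {m n : Type*} [Fintype m] [Fintype n] [DecidableEq n] (A : Matrix m n ℝ) : ℝ :=
  ‖A‖

end Norms

section JSR

open scoped Pointwise ENNReal

/-- The joint spectral radius `limsup_t sup_{B ∈ 𝒜^t} ρ(B)^{1/t}` of a set `𝒜` of real square
matrices, where `𝒜 ^ t` is the set of all `t`-fold products of members of `𝒜` and `ρ(B)` is the
largest modulus of a complex eigenvalue of `B`. It is valued in `[0, ∞]`. -/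
def jsr {n : Type*} [Fintype n] [DecidableEq n] (𝒜 : Set (Matrix n n ℝ)) : ℝ≥0∞ :=
  limsup (fun t : ℕ =>
    ⨆ B ∈ 𝒜 ^ t, (spectralRadius ℂ (B.map Complex.ofReal)) ^ (1 / (t : ℝ))) atTop

end JSR

/-! ### The nonlinear VAR(`k`) model

The model `f₀(z_t) = c + ∑_{i=1}^k f_i(z_{t-i}) + u_t` in `ℝ^p` is parametrised by `c` and by
`f : Fin (k + 1) → (ℝ^p → ℝ^p)`. Vectors of `ℝ^{p(k-1)}` are indexed by `Fin (k - 1) × Fin p`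
(block, position in the block); block number `j` (counted from `0`) is the block with
subscript `j + 1`. -/

variable {p k r L : ℕ}

/-- `π(z) = -f₀(z) + ∑_{i=1}^k f_i(z)`. -/
def piMap (f : Fin (k + 1) → (Fin p → ℝ) → (Fin p → ℝ)) (z : Fin p → ℝ) : Fin p → ℝ :=
  -f 0 z + ∑ i : Fin k, f i.succ z

/-- `g_j(z) = -∑_{i=j+1}^k f_i(z)`. -/
def gMap (f : Fin (k + 1) → (Fin p → ℝ) → (Fin p → ℝ)) (j : ℕ) (z : Fin p → ℝ) : Fin p → ℝ :=
  -∑ i : Fin (k + 1) with j < i.val, f i z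

/-- The stacked map `(θ(z), g_1(z), …, g_{k-1}(z))`. -/
def boldTheta (f : Fin (k + 1) → (Fin p → ℝ) → (Fin p → ℝ)) (θ : (Fin p → ℝ) → (Fin r → ℝ))
    (z : Fin p → ℝ) : Fin r ⊕ (Fin (k - 1) × Fin p) → ℝ :=
  Sum.elim (θ z) (fun x => gMap f ((x.1 : ℕ) + 1) z x.2)

/-- The block matrix `D` with `-I_p` on the diagonal and `I_p` on the superdiagonal. -/
def matD (p k : ℕ) : Matrix (Fin (k - 1) × Fin p) (Fin (k - 1) × Fin p) ℝ :=
  Matrix.of fun x y =>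
    if x.2 = y.2 then
      (if x.1 = y.1 then -1 else if (x.1 : ℕ) + 1 = (y.1 : ℕ) then 1 else 0)
    else 0

/-- `D₀ = [0 0; 0 D]`. -/
def matD0 (p k r : ℕ) :
    Matrix (Fin r ⊕ (Fin (k - 1) × Fin p)) (Fin p ⊕ (Fin (k - 1) × Fin p)) ℝ :=
  Matrix.fromBlocks 0 0 0 (matD p k)

/-- `E = [I_p; 0]`, with `p (k - 1)` rows and `p` columns. -/
def matE (p k : ℕ) : Matrix (Fin (k - 1) × Fin p) (Fin p) ℝ :=
  Matrix.of fun x b => if (x.1 : ℕ) = 0 ∧ x.2 = b then 1 else 0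

/-- Bold `α = [α Eᵀ; 0 I]`. -/
def boldAlpha (k : ℕ) (α : Matrix (Fin p) (Fin r) ℝ) :
    Matrix (Fin p ⊕ (Fin (k - 1) × Fin p)) (Fin r ⊕ (Fin (k - 1) × Fin p)) ℝ :=
  Matrix.fromBlocks α (matE p k).transpose 0 1

/-- The pair (`c`, `f`) satisfies the defining conditions of the class `M_r(α, b, ρ)` with
`c = α μ` and `π = α θ`. -/
structure IsCVARWith (α : Matrix (Fin p) (Fin r) ℝ) (b ρ : ℝ) (c : Fin p → ℝ)
    (f : Fin (k + 1) → (Fin p → ℝ) → (Fin p → ℝ))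
    (μ : Fin r → ℝ) (θ : (Fin p → ℝ) → (Fin r → ℝ)) : Prop where
  rank_alpha : α.rank = r
  rho_nonneg : 0 ≤ ρ
  rho_lt_one : ρ < 1
  homeo : IsHomeomorph (f 0)
  const_eq : c = α.mulVec μ
  pi_eq : ∀ z, piMap f z = α.mulVec (θ z)
  gradient : ∃ ℬ : Set (Matrix (Fin p ⊕ (Fin (k - 1) × Fin p))
      (Fin r ⊕ (Fin (k - 1) × Fin p)) ℝ),
    IsClosed ℬ ∧ (∀ β ∈ ℬ, matNorm β ≤ b) ∧
    jsr {A | ∃ β ∈ ℬ, A = 1 + β.transpose * boldAlpha k α} ≤ ENNReal.ofReal ρ ∧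
    ∀ x x' : Fin p ⊕ (Fin (k - 1) × Fin p) → ℝ, ∃ β ∈ ℬ,
      (boldTheta f θ ((homeo.homeomorph (f 0)).symm (x ∘ Sum.inl)) + (matD0 p k r).mulVec x)
        - (boldTheta f θ ((homeo.homeomorph (f 0)).symm (x' ∘ Sum.inl))
            + (matD0 p k r).mulVec x')
      = β.transpose.mulVec (x - x')

/-- Membership of (`c`, `f`) in the class `M_r(α, b, ρ)`. -/
def InCVARClass (α : Matrix (Fin p) (Fin r) ℝ) (b ρ : ℝ) (c : Fin p → ℝ)
    (f : Fin (k + 1) → (Fin p → ℝ) → (Fin p → ℝ)) : Prop :=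
  ∃ μ θ, IsCVARWith α b ρ c f μ θ

/-- `αp` is an admissible choice of `α_⊥`. -/
def IsOrthCompl (α : Matrix (Fin p) (Fin r) ℝ) (αp : Matrix (Fin p) (Fin (p - r)) ℝ) : Prop :=
  αp.rank = p - r ∧ αp.transpose * α = 0

/-- `χ(z) = (α_⊥ᵀ [f₀(z) - ∑_{i=1}^{k-1} g_i(z)], θ(z))`. -/
def chiMap (αp : Matrix (Fin p) (Fin (p - r)) ℝ) (f : Fin (k + 1) → (Fin p → ℝ) → (Fin p → ℝ))
    (θ : (Fin p → ℝ) → (Fin r → ℝ)) (z : Fin p → ℝ) : Fin (p - r) ⊕ Fin r → ℝ :=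
  Sum.elim (αp.transpose.mulVec (f 0 z - ∑ j ∈ Finset.Icc 1 (k - 1), gMap f j z)) (θ z)

/-! ### Piecewise affine VARs -/

/-- The parameters of a piecewise affine VAR(`k`) on `ℝ^p` with `L` regimes: convex regions
`Z ℓ` partitioning `ℝ^p`, intercepts `φ i ℓ` and matrices `Φ i ℓ` such that
each `f_i(z) = ∑_ℓ 1{z ∈ Z ℓ} (φ i ℓ + Φ i ℓ z)` is continuous. -/
structure PWAModel (p k L : ℕ) where
  Z : Fin L → Set (Fin p → ℝ)
  φ : Fin (k + 1) → Fin L → (Fin p → ℝ)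
  Φ : Fin (k + 1) → Fin L → Matrix (Fin p) (Fin p) ℝ
  convex : ∀ ℓ, Convex ℝ (Z ℓ)
  partition : ∀ z, ∃! ℓ, z ∈ Z ℓ
  continuous : ∀ i, Continuous fun z =>
    ∑ ℓ, (Z ℓ).indicator (fun z => φ i ℓ + (Φ i ℓ).mulVec z) z

namespace PWAModel

/-- `f_i(z) = ∑_ℓ 1{z ∈ Z ℓ} (φ i ℓ + Φ i ℓ z)`. -/
def f (M : PWAModel p k L) (i : Fin (k + 1)) (z : Fin p → ℝ) : Fin p → ℝ :=
  ∑ ℓ, (M.Z ℓ).indicator (fun z => M.φ i ℓ + (M.Φ i ℓ).mulVec z) z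

/-- Intercept of `π` in regime `ℓ`. -/
def piBar (M : PWAModel p k L) (ℓ : Fin L) : Fin p → ℝ :=
  -(M.φ 0 ℓ - ∑ i : Fin k, M.φ i.succ ℓ)

/-- `Π^{(ℓ)}`. -/
def Pi (M : PWAModel p k L) (ℓ : Fin L) : Matrix (Fin p) (Fin p) ℝ :=
  -(M.Φ 0 ℓ - ∑ i : Fin k, M.Φ i.succ ℓ)

/-- `γ̄_j^{(ℓ)} = -∑_{i=j+1}^k φ_i^{(ℓ)}`. -/
def gammaBar (M : PWAModel p k L) (ℓ : Fin L) (j : ℕ) : Fin p → ℝ :=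
  -∑ i : Fin (k + 1) with j < i.val, M.φ i ℓ

/-- `Γ_j^{(ℓ)} = -∑_{i=j+1}^k Φ_i^{(ℓ)}`. -/
def Gamma (M : PWAModel p k L) (ℓ : Fin L) (j : ℕ) : Matrix (Fin p) (Fin p) ℝ :=
  -∑ i : Fin (k + 1) with j < i.val, M.Φ i ℓ

/-- The stacked matrix `[Γ_j^{(ℓ)}]_{j=1}^{k-1}`. -/
def boldGamma (M : PWAModel p k L) (ℓ : Fin L) : Matrix (Fin (k - 1) × Fin p) (Fin p) ℝ :=
  Matrix.of fun x b => M.Gamma ℓ ((x.1 : ℕ) + 1) x.2 b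

/-- Bold `β^{(ℓ)}`, whose transpose is `[β^{(ℓ)ᵀ} Φ₀⁻¹, 0; Γ^{(ℓ)} Φ₀⁻¹, D]`. If `f₀` is a
homeomorphism, `Φ₀^{(ℓ)}` is invertible for every region with nonempty interior; for the remaining
regions, if any, the inverse of a singular matrix is read as `0`. -/
def boldBeta (M : PWAModel p k L) (β : Fin L → Matrix (Fin p) (Fin r) ℝ) (ℓ : Fin L) :
    Matrix (Fin p ⊕ (Fin (k - 1) × Fin p)) (Fin r ⊕ (Fin (k - 1) × Fin p)) ℝ :=
  (Matrix.fromBlocks ((β ℓ).transpose * (M.Φ 0 ℓ)⁻¹) 0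
    (M.boldGamma ℓ * (M.Φ 0 ℓ)⁻¹) (matD p k)).transpose

/-- `φ̄₀^{(ℓ)} - ∑_{j=1}^{k-1} γ̄_j^{(ℓ)}`. -/
def psiBar (M : PWAModel p k L) (ℓ : Fin L) : Fin p → ℝ :=
  M.φ 0 ℓ - ∑ j ∈ Finset.Icc 1 (k - 1), M.gammaBar ℓ j

/-- `Φ₀^{(ℓ)} - ∑_{j=1}^{k-1} Γ_j^{(ℓ)}`. -/
def Psi (M : PWAModel p k L) (ℓ : Fin L) : Matrix (Fin p) (Fin p) ℝ :=
  M.Φ 0 ℓ - ∑ j ∈ Finset.Icc 1 (k - 1), M.Gamma ℓ j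

/-- The cone `{z | a_iᵀ z ≥ 0 for i ∈ I, a_iᵀ z < 0 for i ∉ I}`. -/
def cone (a : Fin p → (Fin p → ℝ)) (I : Set (Fin p)) : Set (Fin p → ℝ) :=
  {z | (∀ i ∈ I, 0 ≤ a i ⬝ᵥ z) ∧ ∀ i ∉ I, a i ⬝ᵥ z < 0}

/-- Piecewise linear VAR. -/
def IsPiecewiseLinear (M : PWAModel p k L) : Prop :=
  (∃ a : Module.Basis (Fin p) ℝ (Fin p → ℝ), ∀ ℓ, ∃ S : Set (Set (Fin p)),
    M.Z ℓ = ⋃ I ∈ S, cone a I) ∧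
  ∀ i ℓ, M.φ i ℓ = 0

/-- Threshold affine VAR. -/
def IsThresholdAffine (M : PWAModel p k L) : Prop :=
  ∃ a : Fin p → ℝ, a ≠ 0 ∧ ∃ τ : Fin (L + 1) → EReal,
    StrictMono τ ∧ τ 0 = ⊥ ∧ τ (Fin.last L) = ⊤ ∧
    ∀ ℓ : Fin L, M.Z ℓ = {z | ((a ⬝ᵥ z : ℝ) : EReal) ∈ Set.Ioc (τ ℓ.castSucc) (τ ℓ.succ)}

/-- All `det Φ₀^{(ℓ)}` have the same nonzero sign. -/
def SameDetSign (M : PWAModel p k L) : Prop :=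
  (∀ ℓ, (M.Φ 0 ℓ).det ≠ 0) ∧
  ∀ ℓ ℓ', SignType.sign (M.Φ 0 ℓ).det = SignType.sign (M.Φ 0 ℓ').det

end PWAModel

end NonlinearVAR

end

/-! All maps involved are continuous and piecewise affine, so along a segment an increment is a
weighted average of regime slopes: it is given by a matrix in the convex hull of finitely many
matrices (`exists_mem_convexHull_increment`). The set ℬ is therefore the hull of the bold β's. It is
compact and inherits the norm bound by convexity. Two facts remain: the bound on the joint spectral
radius survives passage to the hull, and `f₀` is a homeomorphism.

For the first, `(conv 𝒜)^t ⊆ conv (𝒜^t)` and the trace is linear, so a bound on traces of products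
from `𝒜` holds for products from the hull. Traces of powers in turn control the spectral radius,
because the phases of the eigenvalues return simultaneously near 1
(`frequently_half_norm_pow_le_re_sum`).

For the second, if the hull of the `Φ₀` matrices contains only invertible matrices, then `f₀` is
bi-Lipschitz, and a continuity method makes it onto (`isHomeomorph_of_increments`). Invertibility
comes from continuity across regime boundaries. In the threshold case the matrices agree on a
hyperplane, so the determinant is affine on the hull. In the piecewise linear case each column, in a
dual basis, takes only two values, and the determinant is multilinear.

When `f₀` is merely assumed to be a homeomorphism, some `Φ₀` may be singular. The images of those
regions are null, so the closures of the other images cover the space (`exists_mem_closure_image`).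
-/

noncomputable section

namespace NonlinearVAR

variable {p k r L : ℕ}

/-! ### Eigenvalues and traces of powers. -/

section Spectral

open Polynomial

variable {n : Type*} [Fintype n] [DecidableEq n]

theorem det_sub_scalar_eq_prod_roots (A : Matrix n n ℂ) (c : ℂ) :
    (A - algebraMap ℂ _ c).det = (A.charpoly.roots.map fun x => x - c).prod := by
  have hs := IsAlgClosed.splits A.charpoly
  have h1 : (algebraMap ℂ (Matrix n n ℂ) c - A).det = (A.charpoly.roots.map fun x => c - x).prod := by
    have h2 : A.charpoly.eval c = (algebraMap ℂ (Matrix n n ℂ) c - A).det := by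
      rw [Matrix.eval_charpoly]; rfl
    rw [← h2]
    conv_lhs => rw [hs.eq_prod_roots_of_monic A.charpoly_monic]
    rw [eval_multiset_prod, Multiset.map_map]
    simp
  have h3 : A - algebraMap ℂ _ c = -(algebraMap ℂ (Matrix n n ℂ) c - A) := by abel
  have hcard : A.charpoly.roots.card = Fintype.card n := by
    rw [← hs.natDegree_eq_card_roots, A.charpoly_natDegree_eq_dim]
  rw [h3, Matrix.det_neg, h1, ← hcard]
  have h4 : (fun x : ℂ => x - c) = fun x => -1 * (c - x) := by ext; ring
  rw [h4, Multiset.prod_map_mul]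
  simp

theorem det_aeval_prod_X_sub_C (A : Matrix n n ℂ) (s : Multiset ℂ) :
    (aeval A (s.map fun c => X - C c).prod).det =
      (A.charpoly.roots.map fun x => (s.map fun c => x - c).prod).prod := by
  induction s using Multiset.induction with
  | empty => simp
  | cons a s ih =>
    simp only [Multiset.map_cons, Multiset.prod_cons, map_mul, Matrix.det_mul, ih,
      Multiset.prod_map_mul]
    rw [← det_sub_scalar_eq_prod_roots]
    simp

/-- The identity `det q(A) = ∏ q(λ)`, taken at `q = X ^ m - x`, evaluates the characteristic
polynomial of `A ^ m` at each `x` up to a sign. The condition `m ≠ 0` makes `q` monic. -/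
theorem charpoly_pow_roots (A : Matrix n n ℂ) {m : ℕ} (hm : m ≠ 0) :
    (A ^ m).charpoly.roots = A.charpoly.roots.map (· ^ m) := by
  suffices h : (A ^ m).charpoly = ((A.charpoly.roots.map (· ^ m)).map fun x => X - C x).prod by
    rw [h, roots_multiset_prod_X_sub_C]
  apply Polynomial.funext
  intro x
  have hmon : (X ^ m - C x : ℂ[X]).Monic := monic_X_pow_sub_C x hm
  have hp := (IsAlgClosed.splits (X ^ m - C x : ℂ[X])).eq_prod_roots_of_monic hmon
  have h1 := det_aeval_prod_X_sub_C A (X ^ m - C x : ℂ[X]).roots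
  rw [← hp] at h1
  have h2 : ∀ y : ℂ, ((X ^ m - C x : ℂ[X]).roots.map fun c => y - c).prod = y ^ m - x := by
    intro y
    have := congrArg (eval y) hp
    rw [eval_multiset_prod, Multiset.map_map] at this
    simpa using this.symm
  simp only [h2] at h1
  have h4 : (fun y : ℂ => x - y ^ m) = fun y => -1 * (y ^ m - x) := by ext; ring
  have hcard : A.charpoly.roots.card = Fintype.card n := by
    rw [← (IsAlgClosed.splits A.charpoly).natDegree_eq_card_roots, A.charpoly_natDegree_eq_dim]
  rw [eval_multiset_prod, Multiset.map_map, Multiset.map_map, Matrix.eval_charpoly]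
  have h5 : (Matrix.scalar n x - A ^ m) = -(aeval A (X ^ m - C x : ℂ[X])) := by
    simp only [map_sub, map_pow, aeval_X, aeval_C, neg_sub]; rfl
  rw [h5, Matrix.det_neg, h1, ← hcard]
  simp only [Function.comp_def, eval_sub, eval_X, eval_C, h4]
  rw [Multiset.prod_map_mul]
  simp

theorem exists_trace_pow_eq_sum (A : Matrix n n ℂ) :
    ∃ l : Fin (Fintype.card n) → ℂ, (∀ m : ℕ, (A ^ m).trace = ∑ i, l i ^ m) ∧
      ∀ x, x ∈ spectrum ℂ A ↔ ∃ i, l i = x := by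
  have hcard : A.charpoly.roots.card = Fintype.card n := by
    rw [← (IsAlgClosed.splits A.charpoly).natDegree_eq_card_roots, A.charpoly_natDegree_eq_dim]
  obtain ⟨l, hl⟩ : ∃ l : Fin (Fintype.card n) → ℂ, A.charpoly.roots = Finset.univ.val.map l := by
    obtain ⟨L, hL⟩ : ∃ L : List ℂ, (L : Multiset ℂ) = A.charpoly.roots := Quot.exists_rep _
    rw [← hL, Multiset.coe_card] at hcard
    rw [← hL, ← hcard]
    exact ⟨L.get, by rw [Fin.univ_val_map, List.ofFn_get]⟩
  refine ⟨l, fun m => ?_, fun x => ?_⟩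
  · rcases eq_or_ne m 0 with rfl | hm
    · simp [Matrix.trace_one]
    · rw [Matrix.trace_eq_sum_roots_charpoly, charpoly_pow_roots A hm, hl, Multiset.map_map]
      rfl
  · rw [Matrix.mem_spectrum_iff_isRoot_charpoly, ← mem_roots A.charpoly_monic.ne_zero, hl]
    simp

/-- The phases form a point of a compact group, the torus, and the powers of any such point cluster
at the identity. -/
theorem frequently_half_norm_pow_le_re_sum {d : ℕ} (l : Fin d → ℂ) :
    ∃ᶠ m : ℕ in atTop, ∀ i, ‖l i‖ ^ m / 2 ≤ (l i ^ m).re := by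
  let u : Fin d → Circle := fun i => Circle.exp (l i).arg
  have hu : ∀ i, l i = ‖l i‖ * (u i : ℂ) := fun i => by
    simp [u, Circle.coe_exp, Complex.norm_mul_exp_arg_mul_I]
  have hopen : {v : Fin d → Circle | ∀ i, 1 / 2 < ((v i : Circle) : ℂ).re} ∈ 𝓝 1 := by
    apply IsOpen.mem_nhds
    · simp only [Set.ofPred_forall]
      refine isOpen_iInter_of_finite fun i => isOpen_lt continuous_const ?_
      fun_prop
    · intro i; norm_num
  refine ((mapClusterPt_one_atTop_pow u).frequently hopen).mono fun m hm i => ?_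
  have h1 : 1 / 2 < (((u i : Circle) : ℂ) ^ m).re := by simpa using hm i
  rw [hu i, mul_pow, ← Complex.ofReal_pow, Complex.re_ofReal_mul]
  have h2 : 0 ≤ ‖l i‖ ^ m := by positivity
  rw [← hu i]
  nlinarith

/-- At the recurrent times all `l i ^ m` have nonnegative real part, so nothing cancels in the trace
and it dominates half of each `‖l i‖ ^ m`. -/
theorem norm_le_of_trace_pow_le (A : Matrix n n ℂ) {K s : ℝ} (hs : 0 ≤ s)
    (h : ∀ᶠ m : ℕ in atTop, ‖(A ^ m).trace‖ ≤ K * s ^ m) {x : ℂ} (hx : x ∈ spectrum ℂ A) :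
    ‖x‖ ≤ s := by
  obtain ⟨l, hl, hspec⟩ := exists_trace_pow_eq_sum A
  obtain ⟨j, rfl⟩ := (hspec x).1 hx
  by_contra! hlt
  have hpos : 0 < ‖l j‖ := hs.trans_lt hlt
  have hlim : Tendsto (fun m : ℕ => 2 * K * (s / ‖l j‖) ^ m) atTop (𝓝 (2 * K * 0)) :=
    (tendsto_pow_atTop_nhds_zero_of_lt_one (by positivity) ((div_lt_one hpos).2 hlt)).const_mul _
  rw [mul_zero] at hlim
  obtain ⟨m, hm, h1, h2⟩ := ((frequently_half_norm_pow_le_re_sum l).and_eventually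
    (h.and (hlim.eventually (gt_mem_nhds one_pos)))).exists
  have h3 : ‖l j‖ ^ m / 2 ≤ ∑ i, (l i ^ m).re :=
    (hm j).trans (Finset.single_le_sum (f := fun i => (l i ^ m).re)
      (fun i _ => le_trans (by positivity) (hm i)) (Finset.mem_univ j))
  have h4 : ∑ i, (l i ^ m).re ≤ ‖(A ^ m).trace‖ := by
    rw [hl, ← Complex.re_sum]; exact Complex.re_le_norm _
  have h5 : ‖l j‖ ^ m ≤ 2 * K * s ^ m := by linarith
  rw [div_pow, ← mul_div_assoc, div_lt_one (by positivity)] at h2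
  linarith

theorem norm_trace_le (A : Matrix n n ℂ) {s : ℝ} (h : ∀ x ∈ spectrum ℂ A, ‖x‖ ≤ s) :
    ‖A.trace‖ ≤ Fintype.card n * s := by
  obtain ⟨l, hl, hspec⟩ := exists_trace_pow_eq_sum A
  have := hl 1
  simp only [pow_one] at this
  rw [this]
  refine (norm_sum_le _ _).trans ((Finset.sum_le_sum fun i _ => h _ ((hspec _).2 ⟨i, rfl⟩)).trans ?_)
  simp

end Spectral

/-! ### Joint spectral radius of a convex hull. -/

section JointSpectralRadius

open scoped Pointwise ENNReal NNReal

theorem mul_mem_convexHull_mul {R : Type*} [Ring R] [Algebra ℝ R] {s t : Set R} {x y : R}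
    (hx : x ∈ convexHull ℝ s) (hy : y ∈ convexHull ℝ t) : x * y ∈ convexHull ℝ (s * t) := by
  have h1 : ∀ b ∈ t, ∀ x ∈ convexHull ℝ s, x * b ∈ convexHull ℝ (s * t) := by
    intro b hb x hx
    have hc : Convex ℝ ((LinearMap.mulRight ℝ b) ⁻¹' convexHull ℝ (s * t)) :=
      (convex_convexHull ℝ _).linear_preimage _
    have hsub : s ⊆ (LinearMap.mulRight ℝ b) ⁻¹' convexHull ℝ (s * t) :=
      fun a ha => subset_convexHull ℝ (s * t) (Set.mul_mem_mul ha hb)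
    exact convexHull_min hsub hc hx
  have hc : Convex ℝ ((LinearMap.mulLeft ℝ x) ⁻¹' convexHull ℝ (s * t)) :=
    (convex_convexHull ℝ _).linear_preimage _
  exact convexHull_min (fun b hb => h1 b hb x hx) hc hy

theorem convexHull_pow_subset {R : Type*} [Ring R] [Algebra ℝ R] (s : Set R) (m : ℕ) :
    (convexHull ℝ s) ^ m ⊆ convexHull ℝ (s ^ m) := by
  induction m with
  | zero => simpa using subset_convexHull ℝ (1 : Set R)
  | succ m ih =>
    rw [pow_succ, pow_succ]
    rintro _ ⟨x, hx, y, hy, rfl⟩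
    exact mul_mem_convexHull_mul (ih hx) hy

variable {n : Type*} [Fintype n] [DecidableEq n]

theorem spectralRadius_le_iff (A : Matrix n n ℂ) (c : ℝ≥0) :
    spectralRadius ℂ A ≤ c ↔ ∀ x ∈ spectrum ℂ A, ‖x‖ ≤ c := by
  simp only [spectralRadius, iSup_le_iff, ENNReal.coe_le_coe]
  rfl

theorem rpow_one_div_le_iff {x : ℝ≥0∞} {c : ℝ≥0} {t : ℕ} (ht : t ≠ 0) :
    x ^ (1 / (t : ℝ)) ≤ c ↔ x ≤ ((c ^ t : ℝ≥0) : ℝ≥0∞) := by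
  rw [one_div, ENNReal.rpow_inv_le_iff (by positivity), ENNReal.rpow_natCast, ENNReal.coe_pow]

/-- Passing to the convex hull does not increase the joint spectral radius. -/
theorem jsr_convexHull_le (𝒜 : Set (Matrix n n ℝ)) : jsr (convexHull ℝ 𝒜) ≤ jsr 𝒜 := by
  by_contra! hlt
  obtain ⟨c, hc1, hc2⟩ := ENNReal.lt_iff_exists_nnreal_btwn.1 hlt
  refine hc2.not_ge ?_
  -- The spectral radius is not convex, so the bound is moved to the trace before passing to the
  -- hull.
  have hbound : ∀ᶠ t : ℕ in atTop, ∀ C ∈ 𝒜 ^ t, |C.trace| ≤ Fintype.card n * (c : ℝ) ^ t := by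
    filter_upwards [eventually_lt_of_limsup_lt hc1, eventually_ne_atTop 0] with t ht ht0 C hC
    have h1 := (le_iSup₂ (f := fun (B : Matrix n n ℝ) (_ : B ∈ 𝒜 ^ t) =>
      spectralRadius ℂ (B.map Complex.ofReal) ^ (1 / (t : ℝ))) C hC).trans ht.le
    rw [rpow_one_div_le_iff ht0, spectralRadius_le_iff] at h1
    have h2 := norm_trace_le _ h1
    rwa [show (C.map Complex.ofReal).trace = ((C.trace : ℝ) : ℂ) from
      (AddMonoidHom.map_trace Complex.ofRealHom C).symm, Complex.norm_real, Real.norm_eq_abs,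
      NNReal.coe_pow] at h2
  obtain ⟨N, hN⟩ := eventually_atTop.1 hbound
  have hconv : ∀ t ≥ N, ∀ C ∈ (convexHull ℝ 𝒜) ^ t,
      |C.trace| ≤ Fintype.card n * (c : ℝ) ^ t := by
    intro t ht C hC
    have hcv : Convex ℝ ((Matrix.traceLinearMap n ℝ ℝ) ⁻¹'
        Set.Icc (-(Fintype.card n * (c : ℝ) ^ t)) (Fintype.card n * (c : ℝ) ^ t)) :=
      (convex_Icc _ _).linear_preimage _
    exact abs_le.2 (convexHull_min (fun D hD => abs_le.1 (hN t ht D hD)) hcv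
      (convexHull_pow_subset 𝒜 t hC))
  refine limsup_le_of_le (h := ?_)
  filter_upwards [eventually_ne_atTop 0] with t ht0
  refine iSup₂_le fun B hB => ?_
  rw [rpow_one_div_le_iff ht0, spectralRadius_le_iff]
  intro x hx
  refine norm_le_of_trace_pow_le _ (K := Fintype.card n) (NNReal.coe_nonneg _) ?_ hx
  filter_upwards [eventually_ge_atTop N] with m hm
  -- The power `B ^ m` is a product of `t * m` factors, so letting `m` grow reaches the range of the
  -- trace bound for any `t ≠ 0`.
  have h1 := hconv (t * m) (hm.trans (Nat.le_mul_of_pos_left m (Nat.pos_of_ne_zero ht0))) (B ^ m)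
    (by rw [pow_mul]; exact Set.pow_mem_pow hB)
  have h2 : (B.map Complex.ofReal) ^ m = (B ^ m).map Complex.ofReal :=
    (map_pow Complex.ofRealHom.mapMatrix B m).symm
  rw [h2, show ((B ^ m).map Complex.ofReal).trace = (((B ^ m).trace : ℝ) : ℂ) from
      (AddMonoidHom.map_trace Complex.ofRealHom (B ^ m)).symm, Complex.norm_real, Real.norm_eq_abs]
  rwa [NNReal.coe_pow, ← pow_mul]

theorem jsr_mono {𝒜 ℬ : Set (Matrix n n ℝ)} (h : 𝒜 ⊆ ℬ) : jsr 𝒜 ≤ jsr ℬ :=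
  limsup_le_limsup (Eventually.of_forall fun t =>
    biSup_mono fun _ hB => Set.pow_subset_pow_left h hB)

end JointSpectralRadius

/-! ### Increments of piecewise affine maps. -/

section Segment

/-- If a continuous map has, on each piece of a finite closed cover, increments given by `ev (B i)`,
then every increment is given by a member of the convex hull of the `B i`. -/
theorem exists_mem_convexHull_increment {E V W ι : Type*} [Finite ι]
    [NormedAddCommGroup E] [NormedSpace ℝ E] [NormedAddCommGroup V] [NormedSpace ℝ V]
    [AddCommGroup W] [Module ℝ W] (ev : W →ₗ[ℝ] E →ₗ[ℝ] V) (B : ι → W) {G : E → V}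
    (hG : Continuous G) (K : ι → Set E) (hK : ∀ i, IsClosed (K i)) (hcov : ∀ x, ∃ i, x ∈ K i)
    (hB : ∀ i, ∀ x ∈ K i, ∀ y ∈ K i, G x - G y = ev (B i) (x - y)) (x y : E) :
    ∃ A ∈ convexHull ℝ (Set.range B), G x - G y = ev A (x - y) := by
  suffices h : G x - G y ∈ convexHull ℝ (Set.range fun i => ev (B i) (x - y)) by
    rw [show (Set.range fun i => ev (B i) (x - y)) = (ev.flip (x - y)) '' Set.range B by
      rw [← Set.range_comp]; rfl, ← LinearMap.image_convexHull] at h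
    obtain ⟨A, hA, h⟩ := h
    exact ⟨A, hA, h.symm⟩
  set C := convexHull ℝ (Set.range fun i => ev (B i) (x - y)) with hC
  have hCc : IsCompact C := (Set.finite_range _).isCompact_convexHull ℝ
  have hCv : Convex ℝ C := convex_convexHull ℝ _
  have hmem : ∀ i, ev (B i) (x - y) ∈ C := fun i => subset_convexHull ℝ _ ⟨i, rfl⟩
  let γ : ℝ → E := fun t => y + t • (x - y)
  have hγ : Continuous γ := by fun_prop
  -- Real induction on `t`: `S` holds the times at which the mean slope from `y` lies in `C`.
  let S : Set ℝ := {t | ∃ c ∈ C, G (γ t) - G y = t • c}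
  have hS : IsClosed (S ∩ Set.Icc 0 1) := by
    have hcl : IsClosed {q : ℝ × V | G (γ q.1) - G y = q.1 • q.2} :=
      isClosed_eq (by fun_prop) (by fun_prop)
    have himg : S ∩ Set.Icc 0 1 = Prod.fst ''
        ((Set.Icc (0 : ℝ) 1 ×ˢ C) ∩ {q : ℝ × V | G (γ q.1) - G y = q.1 • q.2}) := by
      ext t
      constructor
      · rintro ⟨⟨c, hc, h⟩, ht⟩
        exact ⟨(t, c), ⟨⟨ht, hc⟩, h⟩, rfl⟩
      · rintro ⟨⟨t, c⟩, ⟨⟨ht, hc⟩, h⟩, rfl⟩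
        exact ⟨⟨c, hc, h⟩, ht⟩
    rw [himg]
    exact (((isCompact_Icc.prod hCc).inter_right hcl).image continuous_fst).isClosed
  have h0 : (0 : ℝ) ∈ S := by
    obtain ⟨i, -⟩ := hcov y
    exact ⟨_, hmem i, by simp [γ]⟩
  have hstep : ∀ t ∈ S ∩ Set.Ico 0 1, S ∈ 𝓝[>] t := by
    rintro t ⟨⟨c, hc, hct⟩, ht⟩
    -- Just to the right of `t`, the path meets only closed pieces that already contain `γ t`.
    have hnear : ∀ i, ∀ᶠ s in 𝓝[>] t, γ t ∉ K i → γ s ∉ K i := by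
      intro i
      by_cases hi : γ t ∈ K i
      · exact Eventually.of_forall fun s h => absurd hi h
      · filter_upwards [nhdsWithin_le_nhds
          (hγ.continuousAt.eventually ((hK i).isOpen_compl.mem_nhds hi))] with s hs _ using hs
    filter_upwards [eventually_all.2 hnear, self_mem_nhdsWithin] with s hs hts
    have hts : t < s := hts
    obtain ⟨i, hi⟩ := hcov (γ s)
    have hti : γ t ∈ K i := by
      by_contra h
      exact hs i h hi
    have h1 := hB i _ hi _ hti
    rw [show γ s - γ t = (s - t) • (x - y) by simp only [γ]; module, map_smul] at h1
    have hs0 : 0 < s := ht.1.trans_lt hts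
    -- The mean slope on `[0, s]` averages those on `[0, t]` and `[t, s]`, weighted by length.
    refine ⟨(t / s) • c + ((s - t) / s) • ev (B i) (x - y),
      hCv hc (hmem i) (div_nonneg ht.1 hs0.le) (div_nonneg (by linarith) hs0.le)
        (by field_simp; ring), ?_⟩
    rw [← sub_add_sub_cancel _ (G (γ t)), h1, hct, smul_add, smul_smul, smul_smul,
      mul_div_cancel₀ _ hs0.ne', mul_div_cancel₀ _ hs0.ne', add_comm]
  obtain ⟨c, hc, h⟩ := hS.Icc_subset_of_forall_mem_nhdsWithin h0 hstep
    (Set.right_mem_Icc.2 zero_le_one)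
  have : γ 1 = x := by simp [γ]
  rw [this, one_smul] at h
  rwa [h]

/-- An increment formula on a set extends to its closure. -/
theorem increment_closure {E V : Type*} [NormedAddCommGroup E] [NormedSpace ℝ E]
    [FiniteDimensional ℝ E] [NormedAddCommGroup V] [NormedSpace ℝ V] {G : E → V}
    (hG : Continuous G) (T : E →ₗ[ℝ] V) {K : Set E}
    (h : ∀ x ∈ K, ∀ y ∈ K, G x - G y = T (x - y)) :
    ∀ x ∈ closure K, ∀ y ∈ closure K, G x - G y = T (x - y) := by
  have hT : Continuous T := T.continuous_of_finiteDimensional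
  have h1 : ∀ x ∈ K, ∀ y ∈ closure K, G x - G y = T (x - y) := fun x hx =>
    closure_minimal (h x hx) (isClosed_eq (by fun_prop) (by fun_prop))
  intro x hx y hy
  exact closure_minimal (t := {x | G x - G y = T (x - y)}) (fun x hx => h1 x hx y hy)
    (isClosed_eq (by fun_prop) (by fun_prop)) hx

end Segment

/-! ### Surjectivity by the continuity method. -/

section Continuation

/-- A perturbation, with small Lipschitz constant, of an expanding surjection is surjective. -/
theorem surjective_add_of_lipschitz {E : Type*} [NormedAddCommGroup E]
    [CompleteSpace E] {g h : E → E} {m K : ℝ} (hm : 0 < m) (hK : 0 ≤ K)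
    (hKm : K < m) (hg : ∀ x y, m * ‖x - y‖ ≤ ‖g x - g y‖) (hgs : Function.Surjective g)
    (hh : ∀ x y, ‖h x - h y‖ ≤ K * ‖x - y‖) : Function.Surjective fun x => g x + h x := by
  intro y
  -- A fixed point of `T` solves `g x + h x = y`; `T` contracts by the factor `K / m`.
  choose T hT using fun x => hgs (y - h x)
  have hc : ContractingWith (K / m).toNNReal T := by
    have hnn : 0 ≤ K / m := by positivity
    refine ⟨?_, LipschitzWith.of_dist_le_mul fun x x' => ?_⟩
    · rw [Real.toNNReal_lt_one]
      exact (div_lt_one hm).2 hKm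
    · rw [Real.coe_toNNReal _ hnn, dist_eq_norm, dist_eq_norm, div_mul_eq_mul_div,
        le_div_iff₀ hm, mul_comm]
      refine (hg _ _).trans ?_
      rw [hT, hT, sub_sub_sub_cancel_left, norm_sub_rev]
      exact hh _ _
  refine ⟨hc.fixedPoint, ?_⟩
  have h1 := hT hc.fixedPoint
  rw [hc.fixedPoint_isFixedPt.eq] at h1
  simp only [h1, sub_add_cancel]

/-- Continuity method along the segment from `g` to `g + h`. -/
theorem surjective_add_of_expanding {E : Type*} [NormedAddCommGroup E]
    [NormedSpace ℝ E] [CompleteSpace E] {g h : E → E} {m K : ℝ} (hm : 0 < m) (hK : 0 ≤ K)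
    (hexp : ∀ t ∈ Set.Icc (0 : ℝ) 1, ∀ x y,
      m * ‖x - y‖ ≤ ‖(g x + t • h x) - (g y + t • h y)‖)
    (hgs : Function.Surjective g) (hh : ∀ x y, ‖h x - h y‖ ≤ K * ‖x - y‖) :
    Function.Surjective fun x => g x + h x := by
  -- With `N > K / m`, each step `h / N` has Lipschitz constant `K / N < m`; the expansion constant
  -- `m` does not degrade along the path.
  obtain ⟨N, hN⟩ := exists_nat_gt (K / m)
  have hN0 : 0 < (N : ℝ) := lt_of_le_of_lt (by positivity) hN
  have key : ∀ j : ℕ, j ≤ N → Function.Surjective fun x => g x + ((j : ℝ) / N) • h x := by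
    intro j
    induction j with
    | zero => intro _; simpa using hgs
    | succ j ih =>
      intro hj
      have hjN : (j : ℝ) ≤ N := by exact_mod_cast (Nat.le_succ j).trans hj
      have := surjective_add_of_lipschitz (h := fun x => (1 / (N : ℝ)) • h x) (K := 1 / N * K) hm
        (by positivity) (by rw [div_lt_iff₀ hm] at hN; rw [one_div_mul_eq_div, div_lt_iff₀ hN0]; linarith)
        (hexp (j / N) ⟨by positivity, (div_le_one hN0).2 hjN⟩) (ih ((Nat.le_succ j).trans hj))
        (fun x y => by
          rw [← smul_sub, norm_smul, Real.norm_of_nonneg (by positivity), mul_assoc]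
          exact mul_le_mul_of_nonneg_left (hh x y) (by positivity))
      convert this using 2 with x
      push_cast
      rw [add_div, add_smul, add_assoc]
  have := key N le_rfl
  simpa [div_self hN0.ne'] using this

end Continuation

/-! ### Homeomorphisms from compact convex sets of invertible matrices. -/

section Homeomorphism

variable {n : Type*} [Fintype n] [DecidableEq n]

/-- A map whose increments are given by a compact convex set of invertible matrices is a
homeomorphism. -/
theorem isHomeomorph_of_increments {f : (n → ℝ) → (n → ℝ)} {𝒦 : Set (Matrix n n ℝ)}
    (hcomp : IsCompact 𝒦) (hconv : Convex ℝ 𝒦) (hdet : ∀ A ∈ 𝒦, A.det ≠ 0)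
    (hf : ∀ x y, ∃ A ∈ 𝒦, f x - f y = A.mulVec (x - y)) : IsHomeomorph f := by
  obtain ⟨A₀, hA₀, -⟩ := hf 0 0
  have hscale : ∀ (A : Matrix n n ℝ) (x : n → ℝ),
      ‖A.mulVec x‖ = ‖A.mulVec (‖x‖⁻¹ • x)‖ * ‖x‖ := by
    intro A x
    rcases eq_or_ne x 0 with rfl | hx
    · simp
    · rw [Matrix.mulVec_smul, norm_smul, norm_inv, norm_norm]
      have := norm_ne_zero_iff.2 hx
      field_simp
  have hunit : ∀ x : n → ℝ, x ≠ 0 → ‖x‖⁻¹ • x ∈ Metric.sphere (0 : n → ℝ) 1 := by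
    intro x hx
    simp [norm_smul, inv_mul_cancel₀ (norm_ne_zero_iff.2 hx)]
  have hPc : IsCompact (𝒦 ×ˢ Metric.sphere (0 : n → ℝ) 1) := hcomp.prod (isCompact_sphere _ _)
  have hcont : ContinuousOn (fun q : Matrix n n ℝ × (n → ℝ) => ‖q.1.mulVec q.2‖)
      (𝒦 ×ˢ Metric.sphere (0 : n → ℝ) 1) :=
    (Continuous.norm (continuous_fst.matrix_mulVec continuous_snd)).continuousOn
  obtain ⟨m, hm, hlow⟩ : ∃ m > 0, ∀ A ∈ 𝒦, ∀ x : n → ℝ, m * ‖x‖ ≤ ‖A.mulVec x‖ := by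
    -- Since `A₀ ∈ 𝒦`, the product is empty only if the sphere is, that is, in dimension zero.
    rcases (𝒦 ×ˢ Metric.sphere (0 : n → ℝ) 1).eq_empty_or_nonempty with he | hne
    · refine ⟨1, one_pos, fun A hA x => ?_⟩
      rcases eq_or_ne x 0 with rfl | hx
      · simp
      · exact absurd (show (A, ‖x‖⁻¹ • x) ∈ 𝒦 ×ˢ Metric.sphere (0 : n → ℝ) 1 from
          ⟨hA, hunit x hx⟩) (by simp [he])
    · obtain ⟨⟨B, u⟩, ⟨hB, hu⟩, hmin⟩ := hPc.exists_isMinOn hne hcont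
      have hu0 : u ≠ 0 := by
        rintro rfl
        simp at hu
      refine ⟨‖B.mulVec u‖, (norm_pos_iff (a := B.mulVec u)).2 fun h => hu0
        (Matrix.eq_zero_of_mulVec_eq_zero (hdet B hB) h), fun A hA x => ?_⟩
      rcases eq_or_ne x 0 with rfl | hx
      · simp
      · rw [hscale A x]
        exact mul_le_mul_of_nonneg_right
          (hmin (show (A, ‖x‖⁻¹ • x) ∈ 𝒦 ×ˢ Metric.sphere (0 : n → ℝ) 1 from ⟨hA, hunit x hx⟩))
          (norm_nonneg _)
  obtain ⟨K, hK, hup⟩ : ∃ K ≥ 0, ∀ A ∈ 𝒦, ∀ x : n → ℝ, ‖A.mulVec x‖ ≤ K * ‖x‖ := by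
    obtain ⟨K, hK⟩ := hPc.exists_bound_of_continuousOn hcont
    refine ⟨max K 0, le_max_right _ _, fun A hA x => ?_⟩
    rcases eq_or_ne x 0 with rfl | hx
    · simp
    · rw [hscale A x]
      refine mul_le_mul_of_nonneg_right (le_trans ?_ (le_max_left _ _)) (norm_nonneg _)
      simpa using hK (A, ‖x‖⁻¹ • x) ⟨hA, hunit x hx⟩
  have hlip : ∀ x y, ‖f x - f y‖ ≤ K * ‖x - y‖ := by
    intro x y
    obtain ⟨A, hA, h⟩ := hf x y
    rw [h]
    exact hup A hA _
  have hanti : ∀ x y, m * ‖x - y‖ ≤ ‖f x - f y‖ := by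
    intro x y
    obtain ⟨A, hA, h⟩ := hf x y
    rw [h]
    exact hlow A hA _
  have hsurj : Function.Surjective f := by
    -- The path runs from the linear map `A₀` to `f`. Its increments are given by `(1 - t) • A₀ + t
    -- • A`, which stays in `𝒦` by convexity.
    have h := surjective_add_of_expanding (g := A₀.mulVec) (h := fun x => f x - A₀.mulVec x)
      (m := m) (K := K + K) hm (by positivity) ?_ ?_ ?_
    · simpa using h
    · intro t ht x y
      obtain ⟨A, hA, h⟩ := hf x y
      have := hlow _ (hconv hA₀ hA (sub_nonneg.2 ht.2) ht.1 (by ring)) (x - y)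
      refine this.trans_eq (congrArg _ ?_)
      rw [Matrix.add_mulVec, Matrix.smul_mulVec, Matrix.smul_mulVec, ← h, Matrix.mulVec_sub]
      module
    · intro y
      refine ⟨A₀⁻¹.mulVec y, ?_⟩
      rw [Matrix.mulVec_mulVec, Matrix.mul_nonsing_inv _ (isUnit_iff_ne_zero.2 (hdet A₀ hA₀)),
        Matrix.one_mulVec]
    · intro x y
      rw [show f x - A₀.mulVec x - (f y - A₀.mulVec y) = (f x - f y) - A₀.mulVec (x - y) by
        rw [Matrix.mulVec_sub]; abel, add_mul]
      exact (norm_sub_le _ _).trans (add_le_add (hlip x y) (hup A₀ hA₀ _))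
  have hL : LipschitzWith K.toNNReal f := LipschitzWith.of_dist_le_mul fun x y => by
    rw [Real.coe_toNNReal _ hK, dist_eq_norm, dist_eq_norm]
    exact hlip x y
  have hA : AntilipschitzWith (m⁻¹).toNNReal f := AntilipschitzWith.of_le_mul_dist fun x y => by
    rw [Real.coe_toNNReal _ (by positivity), dist_eq_norm, dist_eq_norm, inv_mul_eq_div,
      le_div_iff₀ hm, mul_comm]
    exact hanti x y
  exact isHomeomorph_iff_isEmbedding_surjective.2
    ⟨(hA.isClosedEmbedding hL.uniformContinuous).isEmbedding, hsurj⟩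

end Homeomorphism

namespace PWAModel

theorem sum_indicator_eq (M : PWAModel p k L) {V : Type*} [AddCommMonoid V]
    (h : Fin L → (Fin p → ℝ) → V) {ℓ : Fin L} {z : Fin p → ℝ} (hz : z ∈ M.Z ℓ) :
    ∑ ℓ', (M.Z ℓ').indicator (h ℓ') z = h ℓ z := by
  rw [Finset.sum_eq_single ℓ]
  · exact Set.indicator_of_mem hz _
  · intro ℓ' _ hne
    exact Set.indicator_of_notMem (fun hz' => hne ((M.partition z).unique hz' hz)) _
  · simp

theorem f_eq (M : PWAModel p k L) (i : Fin (k + 1)) {ℓ : Fin L} {z : Fin p → ℝ}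
    (hz : z ∈ M.Z ℓ) : M.f i z = M.φ i ℓ + (M.Φ i ℓ).mulVec z :=
  M.sum_indicator_eq (fun ℓ z => M.φ i ℓ + (M.Φ i ℓ).mulVec z) hz

theorem continuous_f (M : PWAModel p k L) (i : Fin (k + 1)) : Continuous (M.f i) :=
  M.continuous i

theorem f_sub_closure (M : PWAModel p k L) (i : Fin (k + 1)) (ℓ : Fin L) :
    ∀ x ∈ closure (M.Z ℓ), ∀ y ∈ closure (M.Z ℓ),
      M.f i x - M.f i y = (M.Φ i ℓ).mulVec (x - y) :=
  increment_closure (M.continuous_f i) (M.Φ i ℓ).mulVecLin fun x hx y hy => by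
    rw [M.f_eq i hx, M.f_eq i hy, Matrix.mulVecLin_apply, Matrix.mulVec_sub]
    abel

/-- The coefficient matrices of `f₀` on the nonempty regions. -/
def activeΦ (M : PWAModel p k L) : Set (Matrix (Fin p) (Fin p) ℝ) :=
  Set.range fun ℓ : {ℓ : Fin L // (M.Z ℓ).Nonempty} => M.Φ 0 ℓ

/-- The closures of the nonempty regions form a finite closed cover with linear increments. Empty
regions are dropped because nothing constrains their matrices. -/
theorem isHomeomorph_of_det_ne_zero (M : PWAModel p k L)
    (h : ∀ A ∈ convexHull ℝ M.activeΦ, A.det ≠ 0) : IsHomeomorph (M.f 0) := by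
  refine isHomeomorph_of_increments ((Set.finite_range _).isCompact_convexHull ℝ)
    (convex_convexHull ℝ _) h ?_
  exact exists_mem_convexHull_increment (Matrix.mulVecBilin ℝ ℝ)
    (fun ℓ : {ℓ : Fin L // (M.Z ℓ).Nonempty} => M.Φ 0 ℓ) (M.continuous_f 0)
    (fun ℓ => closure (M.Z ℓ)) (fun _ => isClosed_closure)
    (fun x => by
      obtain ⟨ℓ, hℓ, -⟩ := M.partition x
      exact ⟨⟨ℓ, x, hℓ⟩, subset_closure hℓ⟩)
    (fun ℓ x hx y hy => M.f_sub_closure 0 ℓ x hx y hy)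

end PWAModel

/-! ### Determinants on convex hulls. -/

section Determinants

variable {n : Type*} [Fintype n] [DecidableEq n]

/-- Matrices with positive determinant (up to sign) that agree on a hyperplane form a convex set. -/
theorem convex_det_pos_of_eqOn_hyperplane (A₀ : Matrix n n ℝ) (hA₀ : A₀.det ≠ 0) (a : n → ℝ)
    (ha : a ≠ 0) (s : ℝ) :
    Convex ℝ {A : Matrix n n ℝ | (∀ v, a ⬝ᵥ v = 0 → A.mulVec v = A₀.mulVec v) ∧ 0 < s * A.det} := by
  have haa : a ⬝ᵥ a ≠ 0 := fun h => ha (dotProduct_self_eq_zero.1 h)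
  have hdet : ∀ A : Matrix n n ℝ, (∀ v, a ⬝ᵥ v = 0 → A.mulVec v = A₀.mulVec v) →
      A.det = A₀.det * (1 + a ⬝ᵥ A₀⁻¹.mulVec ((a ⬝ᵥ a)⁻¹ • (A - A₀).mulVec a)) := by
    intro A hA
    set w := (a ⬝ᵥ a)⁻¹ • (A - A₀).mulVec a with hw
    -- A difference vanishing on the hyperplane orthogonal to `a` has rank at most one, so the
    -- matrix determinant lemma makes `det` affine in `A`.
    have h1 : A = A₀ + Matrix.replicateCol Unit w * Matrix.replicateRow Unit a := by
      apply Matrix.ext_of_mulVec_single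
      intro i
      have h2 := hA (Pi.single i 1 - (a i / (a ⬝ᵥ a)) • a) (by
        rw [dotProduct_sub, dotProduct_smul, dotProduct_single_one, smul_eq_mul,
          div_mul_cancel₀ _ haa, sub_self])
      rw [Matrix.mulVec_sub, Matrix.mulVec_sub, Matrix.mulVec_smul, Matrix.mulVec_smul] at h2
      have h3 : (Matrix.replicateCol Unit w * Matrix.replicateRow Unit a).mulVec (Pi.single i 1)
          = a i • w := by
        ext j
        simp [Matrix.mul_apply, mul_comm]
      rw [Matrix.add_mulVec, h3, hw, Matrix.sub_mulVec, smul_smul, ← div_eq_mul_inv, smul_sub]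
      linear_combination (exp := 1) h2
    conv_lhs => rw [h1]
    rw [Matrix.det_add_replicateCol_mul_replicateRow (isUnit_iff_ne_zero.2 hA₀)]
    congr 1
    rw [Matrix.det_unique, Matrix.add_apply, Matrix.one_apply_eq, Matrix.mul_assoc]
    congr 1
  rintro A ⟨hA, hA'⟩ B ⟨hB, hB'⟩ x y hx hy hxy
  have hAB : ∀ v, a ⬝ᵥ v = 0 → (x • A + y • B).mulVec v = A₀.mulVec v := by
    intro v hv
    rw [Matrix.add_mulVec, Matrix.smul_mulVec, Matrix.smul_mulVec, hA v hv, hB v hv, ← add_smul,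
      hxy, one_smul]
  refine ⟨hAB, ?_⟩
  have key : (x • A + y • B).det = x * A.det + y * B.det := by
    rw [hdet _ hAB, hdet _ hA, hdet _ hB]
    have h4 : (x • A + y • B - A₀) = x • (A - A₀) + y • (B - A₀) := by
      have : A₀ = x • A₀ + y • A₀ := by rw [← add_smul, hxy, one_smul]
      conv_lhs => rw [this]
      simp only [smul_sub]; abel
    rw [h4]
    simp only [Matrix.add_mulVec, Matrix.smul_mulVec, smul_add, Matrix.mulVec_add,
      Matrix.mulVec_smul, dotProduct_add, dotProduct_smul, smul_eq_mul]
    obtain rfl : y = 1 - x := by linarith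
    ring
  rw [key]
  rcases hx.eq_or_lt with rfl | hx
  · rw [zero_add] at hxy
    simpa [hxy] using hB'
  · nlinarith [mul_pos hx hA', mul_nonneg hy hB'.le]

/-- If the determinant is positive (up to sign) for all choices of columns among `u i`, `w i`, then
it is so for all columns in the segments `[u i, w i]`. -/
theorem det_pos_of_cols_mem_segment (u w : n → n → ℝ) (s : ℝ)
    (h : ∀ v : n → n → ℝ, (∀ i, v i = u i ∨ v i = w i) → 0 < s * (Matrix.of v).det)
    (v : n → n → ℝ) (hv : ∀ i, v i ∈ segment ℝ (u i) (w i)) : 0 < s * (Matrix.of v).det := by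
  -- Vertices are replaced by segment points one index at a time; `det` is linear in each.
  suffices H : ∀ (S : Finset n) (v : n → n → ℝ), (∀ i ∈ S, v i ∈ segment ℝ (u i) (w i)) →
      (∀ i ∉ S, v i = u i ∨ v i = w i) → 0 < s * (Matrix.of v).det from
    H Finset.univ v (fun i _ => hv i) (by simp)
  intro S
  induction S using Finset.induction_on with
  | empty => exact fun v _ hv => h v fun i => hv i (Finset.notMem_empty i)
  | insert j S hj ih =>
    intro v hv1 hv2
    have hupd : ∀ c, (c = u j ∨ c = w j) → 0 < s * (Matrix.of (Function.update v j c)).det := by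
      intro c hc
      apply ih
      · intro i hi
        rw [Function.update_of_ne (by rintro rfl; exact hj hi)]
        exact hv1 i (Finset.mem_insert_of_mem hi)
      · intro i hi
        rcases eq_or_ne i j with rfl | hij
        · simpa using hc
        · rw [Function.update_of_ne hij]
          exact hv2 i (by simp [hij, hi])
    obtain ⟨x, y, hx, hy, hxy, hvj⟩ := hv1 j (Finset.mem_insert_self j S)
    have hdet : (Matrix.of v).det = x * (Matrix.of (Function.update v j (u j))).det
        + y * (Matrix.of (Function.update v j (w j))).det := by
      have h1 : v = Function.update v j (x • u j + y • w j) := by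
        rw [hvj, Function.update_eq_self]
      have h2 : ∀ M : n → n → ℝ, (Matrix.of M).det = Matrix.detRowAlternating M := fun _ => rfl
      conv_lhs => rw [h1]
      simp only [h2, AlternatingMap.map_update_add, AlternatingMap.map_update_smul, smul_eq_mul]
    rw [hdet]
    have hu := hupd _ (Or.inl rfl)
    have hw := hupd _ (Or.inr rfl)
    rcases hx.eq_or_lt with rfl | hx
    · rw [zero_add] at hxy
      simpa [hxy] using hw
    · nlinarith [mul_pos hx hu, mul_nonneg hy hw.le]

end Determinants

/-! ### Threshold affine and piecewise linear models. -/

namespace PWAModel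

theorem SameDetSign.mul_pos {M : PWAModel p k L} (h : M.SameDetSign) (ℓ ℓ' : Fin L) :
    0 < (M.Φ 0 ℓ).det * (M.Φ 0 ℓ').det := by
  rw [← sign_eq_one_iff, sign_mul, h.2 ℓ' ℓ, ← sign_mul]
  exact sign_eq_one_iff.2 (mul_self_pos.2 (h.1 ℓ))

/-- Neighbouring closed regions share a hyperplane parallel to `v`, on which both matrices compute
the same increment of the continuous `f i`. -/
theorem IsThresholdAffine.Φ_mulVec_eq {M : PWAModel p k L} {a : Fin p → ℝ} (ha : a ≠ 0)
    {τ : Fin (L + 1) → EReal} (hτ : StrictMono τ)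
    (hZ : ∀ ℓ : Fin L,
      M.Z ℓ = {z | ((a ⬝ᵥ z : ℝ) : EReal) ∈ Set.Ioc (τ ℓ.castSucc) (τ ℓ.succ)})
    (i : Fin (k + 1)) {v : Fin p → ℝ} (hv : a ⬝ᵥ v = 0) :
    ∀ (m : ℕ) (hm : m < L), (M.Φ i ⟨m, hm⟩).mulVec v = (M.Φ i ⟨0, by omega⟩).mulVec v := by
  have haa : a ⬝ᵥ a ≠ 0 := fun h => ha (dotProduct_self_eq_zero.1 h)
  intro m
  induction m with
  | zero => exact fun _ => rfl
  | succ m ih =>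
    intro hm
    rw [← ih (by omega)]
    set ℓ : Fin L := ⟨m, by omega⟩
    set ℓ' : Fin L := ⟨m + 1, hm⟩
    have hcs : ℓ'.castSucc = ℓ.succ := rfl
    have hlt1 : τ ℓ.castSucc < τ ℓ.succ := hτ (Fin.castSucc_lt_succ)
    have hlt2 : τ ℓ.succ < τ ℓ'.succ := hcs ▸ hτ (Fin.castSucc_lt_succ)
    obtain ⟨t, ht⟩ : ∃ t : ℝ, (t : EReal) = τ ℓ.succ :=
      ⟨_, EReal.coe_toReal (ne_top_of_lt hlt2) (ne_bot_of_gt hlt1)⟩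
    have hdiff : ∀ (j : Fin L) (z : Fin p → ℝ), z ∈ closure (M.Z j) → z + v ∈ closure (M.Z j) →
        (M.Φ i j).mulVec v = M.f i (z + v) - M.f i z := by
      intro j z h1 h2
      rw [M.f_sub_closure i j _ h2 _ h1, add_sub_cancel_left]
    have hleft : ∀ z, a ⬝ᵥ z = t → z ∈ closure (M.Z ℓ) := by
      intro z hz
      apply subset_closure
      rw [hZ, Set.mem_ofPred_eq, hz, ht]
      exact ⟨hlt1, le_rfl⟩
    -- The intervals are open on the left, so the hyperplane is only in the closure of the upper
    -- region.
    have hright : ∀ z, a ⬝ᵥ z = t → z ∈ closure (M.Z ℓ') := by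
      intro z hz
      have hlim : Tendsto (fun ε : ℝ => z + (ε / (a ⬝ᵥ a)) • a) (𝓝[>] 0) (𝓝 z) := by
        have hc : Continuous fun ε : ℝ => z + (ε / (a ⬝ᵥ a)) • a := by fun_prop
        simpa using (hc.tendsto 0).mono_left nhdsWithin_le_nhds
      refine mem_closure_of_tendsto hlim ?_
      have hev : ∀ᶠ ε : ℝ in 𝓝[>] 0, ((t + ε : ℝ) : EReal) < τ ℓ'.succ := by
        have hc : Tendsto (fun ε : ℝ => ((t + ε : ℝ) : EReal)) (𝓝[>] 0) (𝓝 (t : EReal)) := by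
          have hc : Continuous fun ε : ℝ => ((t + ε : ℝ) : EReal) :=
            continuous_coe_real_ereal.comp (by fun_prop)
          simpa using (hc.tendsto 0).mono_left nhdsWithin_le_nhds
        exact hc.eventually (gt_mem_nhds (ht ▸ hlt2))
      filter_upwards [hev, self_mem_nhdsWithin] with ε h1 h2
      have h2 : 0 < ε := h2
      rw [hZ, Set.mem_ofPred_eq, dotProduct_add, dotProduct_smul, smul_eq_mul,
        div_mul_cancel₀ _ haa, hz, hcs, ← ht]
      exact ⟨EReal.coe_lt_coe_iff.2 (by linarith), h1.le⟩
    have hz : a ⬝ᵥ ((t / (a ⬝ᵥ a)) • a) = t := by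
      rw [dotProduct_smul, smul_eq_mul, div_mul_cancel₀ _ haa]
    have hzv : a ⬝ᵥ ((t / (a ⬝ᵥ a)) • a + v) = t := by rw [dotProduct_add, hz, hv, add_zero]
    rw [hdiff ℓ' _ (hright _ hz) (hright _ hzv), hdiff ℓ _ (hleft _ hz) (hleft _ hzv)]

theorem IsThresholdAffine.isHomeomorph {M : PWAModel p k L} (hM : M.IsThresholdAffine)
    (hs : M.SameDetSign) : IsHomeomorph (M.f 0) := by
  obtain ⟨a, ha, τ, hτ, -, -, hZ⟩ := hM
  obtain ⟨ℓ₀, -, -⟩ := M.partition 0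
  have hΦ : ∀ ℓ, ∀ v, a ⬝ᵥ v = 0 → (M.Φ 0 ℓ).mulVec v = (M.Φ 0 ℓ₀).mulVec v := by
    intro ℓ v hv
    exact (IsThresholdAffine.Φ_mulVec_eq ha hτ hZ 0 hv ℓ ℓ.2).trans
      (IsThresholdAffine.Φ_mulVec_eq ha hτ hZ 0 hv ℓ₀ ℓ₀.2).symm
  refine M.isHomeomorph_of_det_ne_zero fun A hA => ?_
  have hsub : M.activeΦ ⊆ {A | (∀ v, a ⬝ᵥ v = 0 → A.mulVec v = (M.Φ 0 ℓ₀).mulVec v) ∧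
      0 < (M.Φ 0 ℓ₀).det * A.det} := by
    rintro _ ⟨ℓ, rfl⟩
    exact ⟨hΦ ℓ, hs.mul_pos ℓ₀ ℓ⟩
  have h := convexHull_min hsub
    (convex_det_pos_of_eqOn_hyperplane (M.Φ 0 ℓ₀) (hs.1 ℓ₀) a ha (M.Φ 0 ℓ₀).det) hA
  exact right_ne_zero_of_mul h.2.ne'

section Cones

theorem mem_closure_cone {a : Fin p → Fin p → ℝ} {I : Set (Fin p)} {c x : Fin p → ℝ}
    (hc1 : ∀ i ∈ I, 0 < a i ⬝ᵥ c) (hc2 : ∀ i ∉ I, a i ⬝ᵥ c < 0)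
    (hx1 : ∀ i ∈ I, 0 ≤ a i ⬝ᵥ x) (hx2 : ∀ i ∉ I, a i ⬝ᵥ x ≤ 0) : x ∈ closure (cone a I) := by
  have hlim : Tendsto (fun ε : ℝ => x + ε • c) (𝓝[>] 0) (𝓝 x) := by
    have hc : Continuous fun ε : ℝ => x + ε • c := by fun_prop
    simpa using (hc.tendsto 0).mono_left nhdsWithin_le_nhds
  refine mem_closure_of_tendsto hlim ?_
  filter_upwards [self_mem_nhdsWithin] with ε hε
  have hε : 0 < ε := hε
  refine ⟨fun i hi => ?_, fun i hi => ?_⟩ <;> rw [dotProduct_add, dotProduct_smul, smul_eq_mul]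
  · have := mul_pos hε (hc1 i hi)
    linarith [hx1 i hi]
  · have := mul_neg_of_pos_of_neg hε (hc2 i hi)
    linarith [hx2 i hi]

theorem cone_index_unique {a : Fin p → Fin p → ℝ} {I J : Set (Fin p)} {c : Fin p → ℝ}
    (hI : c ∈ cone a I) (hJ : c ∈ cone a J) : I = J := by
  ext i
  constructor
  · intro hi
    by_contra hj
    exact (hI.1 i hi).not_gt (hJ.2 i hj)
  · intro hi
    by_contra hj
    exact (hJ.1 i hi).not_gt (hI.2 i hj)

/-- In the basis `e` dual to `a`, the vectors `e i` and `-e i` lie in closed cones on either side of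
the `i`-th hyperplane, so the `i`-th column of every `Φ₀` is one of two values `u i`, `w i`. -/
theorem IsPiecewiseLinear.isHomeomorph {M : PWAModel p k L} (hM : M.IsPiecewiseLinear)
    (hs : M.SameDetSign) : IsHomeomorph (M.f 0) := by
  classical
  obtain ⟨⟨a, hZ⟩, -⟩ := hM
  obtain ⟨ℓ₀, -, -⟩ := M.partition 0
  have hdetA : IsUnit (Matrix.of a).det :=
    (Matrix.isUnit_iff_isUnit_det _).1
      (Matrix.linearIndependent_rows_iff_isUnit.1 a.linearIndependent)
  set B := (Matrix.of a)⁻¹ with hB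
  have hBdet : B.det ≠ 0 := (Matrix.isUnit_nonsing_inv_det _ hdetA).ne_zero
  let e : Fin p → Fin p → ℝ := fun i j => B j i
  have hae : ∀ i j, a i ⬝ᵥ e j = if i = j then 1 else 0 := by
    intro i j
    have := congrFun (congrFun (Matrix.mul_nonsing_inv _ hdetA) i) j
    rwa [Matrix.one_apply, Matrix.mul_apply] at this
  have hpoint : ∀ I : Set (Fin p), ∃ c : Fin p → ℝ,
      (∀ i ∈ I, 0 < a i ⬝ᵥ c) ∧ ∀ i ∉ I, a i ⬝ᵥ c < 0 := by
    intro I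
    refine ⟨B.mulVec fun i => if i ∈ I then 1 else -1, ?_⟩
    have h : ∀ i, a i ⬝ᵥ (B.mulVec fun i => if i ∈ I then (1 : ℝ) else -1)
        = if i ∈ I then 1 else -1 := by
      intro i
      have h1 : (Matrix.of a).mulVec (B.mulVec fun i => if i ∈ I then (1 : ℝ) else -1)
          = fun i => if i ∈ I then 1 else -1 := by
        rw [Matrix.mulVec_mulVec, Matrix.mul_nonsing_inv _ hdetA, Matrix.one_mulVec]
      exact congrFun h1 i
    exact ⟨fun i hi => by rw [h, if_pos hi]; norm_num, fun i hi => by rw [h, if_neg hi]; norm_num⟩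
  let u : Fin p → Fin p → ℝ := fun i => M.f 0 (e i) - M.f 0 0
  let w : Fin p → Fin p → ℝ := fun i => M.f 0 0 - M.f 0 (-e i)
  have hcols : ∀ ℓ I, cone a I ⊆ M.Z ℓ →
      ∀ i, (i ∈ I → (M.Φ 0 ℓ).mulVec (e i) = u i) ∧ (i ∉ I → (M.Φ 0 ℓ).mulVec (e i) = w i) := by
    intro ℓ I hI i
    obtain ⟨c, hc1, hc2⟩ := hpoint I
    have h0 : (0 : Fin p → ℝ) ∈ closure (M.Z ℓ) :=
      closure_mono hI (mem_closure_cone hc1 hc2 (by simp) (by simp))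
    constructor
    · intro hi
      have h1 : e i ∈ closure (M.Z ℓ) := closure_mono hI (mem_closure_cone hc1 hc2
        (fun j _ => by rw [hae]; split_ifs <;> norm_num)
        (fun j hj => by rw [hae, if_neg (by rintro rfl; exact hj hi)]))
      simp only [u]
      rw [M.f_sub_closure 0 ℓ _ h1 _ h0, sub_zero]
    · intro hi
      have h1 : -e i ∈ closure (M.Z ℓ) := closure_mono hI (mem_closure_cone hc1 hc2
        (fun j hj => by rw [dotProduct_neg, hae, if_neg (by rintro rfl; exact hi hj), neg_zero])
        (fun j _ => by rw [dotProduct_neg, hae]; split_ifs <;> norm_num))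
      simp only [w]
      rw [M.f_sub_closure 0 ℓ _ h0 _ h1, zero_sub, neg_neg]
  have hdet : ∀ A : Matrix (Fin p) (Fin p) ℝ,
      (Matrix.of fun i => A.mulVec (e i)).det = A.det * B.det := by
    intro A
    rw [← Matrix.det_mul, ← Matrix.det_transpose]
    rfl
  refine M.isHomeomorph_of_det_ne_zero fun A hA => ?_
  have hseg : ∀ i, A.mulVec (e i) ∈ segment ℝ (u i) (w i) := by
    intro i
    have hc : Convex ℝ (((Matrix.mulVecBilin ℝ ℝ).flip (e i)) ⁻¹' segment ℝ (u i) (w i) :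
        Set (Matrix (Fin p) (Fin p) ℝ)) := (convex_segment _ _).linear_preimage _
    refine convexHull_min ?_ hc hA
    rintro _ ⟨⟨ℓ, x, hx⟩, rfl⟩
    obtain ⟨S, hS⟩ := hZ ℓ
    rw [hS] at hx
    obtain ⟨I, hI, hxI⟩ := Set.mem_iUnion₂.1 hx
    have hsub : cone a I ⊆ M.Z ℓ := by
      rw [hS]
      exact Set.subset_biUnion_of_mem hI
    change (M.Φ 0 ℓ).mulVec (e i) ∈ segment ℝ (u i) (w i)
    by_cases hi : i ∈ I
    · rw [(hcols ℓ I hsub i).1 hi]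
      exact left_mem_segment ℝ _ _
    · rw [(hcols ℓ I hsub i).2 hi]
      exact right_mem_segment ℝ _ _
  have hpos := det_pos_of_cols_mem_segment u w ((M.Φ 0 ℓ₀).det * B.det) ?_ _ hseg
  · rw [hdet] at hpos
    exact left_ne_zero_of_mul (right_ne_zero_of_mul hpos.ne')
  -- Every choice of columns is realised by a regime: the one containing the cone whose index set
  -- records where `u` was chosen.
  · intro v hv
    obtain ⟨c, hc1, hc2⟩ := hpoint {i | v i = u i}
    have hcI : c ∈ cone a {i | v i = u i} := ⟨fun i hi => (hc1 i hi).le, hc2⟩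
    obtain ⟨ℓ, hℓ, -⟩ := M.partition c
    obtain ⟨S, hS⟩ := hZ ℓ
    have hℓ' := hℓ
    simp only [hS] at hℓ'
    obtain ⟨J, hJ, hcJ⟩ := Set.mem_iUnion₂.1 hℓ'
    have hsub : cone a {i | v i = u i} ⊆ M.Z ℓ := by
      rw [hS, cone_index_unique hcI hcJ]
      exact Set.subset_biUnion_of_mem hJ
    have hvΦ : v = fun i => (M.Φ 0 ℓ).mulVec (e i) := by
      funext i
      by_cases hi : v i = u i
      · rw [(hcols ℓ _ hsub i).1 hi, hi]
      · rw [(hcols ℓ _ hsub i).2 hi, (hv i).resolve_left hi]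
    rw [hvΦ, hdet]
    have h1 := hs.mul_pos ℓ₀ ℓ
    have h2 := mul_self_pos.2 hBdet
    calc 0 < ((M.Φ 0 ℓ₀).det * (M.Φ 0 ℓ).det) * (B.det * B.det) := _root_.mul_pos h1 h2
      _ = _ := by ring

end Cones

end PWAModel

theorem mulVec_injective_of_rank_eq {m n : ℕ} {A : Matrix (Fin m) (Fin n) ℝ} (h : A.rank = n) :
    Function.Injective A.mulVec := by
  have h1 := A.mulVecLin.finrank_range_add_finrank_ker
  rw [Module.finrank_fin_fun] at h1
  have h2 : Module.finrank ℝ A.mulVecLin.range = n := h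
  have h3 : Module.finrank ℝ A.mulVecLin.ker = 0 := by omega
  exact LinearMap.ker_eq_bot.1 (Submodule.finrank_eq_zero.1 h3)

/-! ### The bold β's: bounds under convex hulls. -/

section Norms

open scoped Matrix.Norms.L2Operator

theorem convex_matNorm_le {m n : Type*} [Fintype m] [Fintype n] [DecidableEq n] (b : ℝ) :
    Convex ℝ {A : Matrix m n ℝ | matNorm A ≤ b} := by
  have h : {A : Matrix m n ℝ | matNorm A ≤ b} = Metric.closedBall 0 b := by
    ext A
    simp [matNorm]
  rw [h]
  exact convex_closedBall 0 b

end Norms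

/-- The map `β ↦ 1 + βᵀ A` is affine, so it sends the hull into the hull of the images. -/
theorem jsr_affine_convexHull_le {m n : Type*} [Fintype m] [Fintype n] [DecidableEq n]
    {ι : Type*} (B : ι → Matrix m n ℝ) (A : Matrix m n ℝ) :
    jsr {C | ∃ β ∈ convexHull ℝ (Set.range B), C = 1 + β.transpose * A}
      ≤ jsr (Set.range fun i => 1 + (B i).transpose * A) := by
  refine (jsr_mono ?_).trans (jsr_convexHull_le _)
  rintro _ ⟨β, hβ, rfl⟩
  have hc : Convex ℝ {β : Matrix m n ℝ | 1 + β.transpose * A ∈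
      convexHull ℝ (Set.range fun i => 1 + (B i).transpose * A)} := by
    intro x hx y hy s t hs ht hst
    have h := convex_convexHull ℝ (Set.range fun i => 1 + (B i).transpose * A) hx hy hs ht hst
    have h1 : s • (1 + x.transpose * A) + t • (1 + y.transpose * A)
        = 1 + (s • x + t • y).transpose * A := by
      rw [Matrix.transpose_add, Matrix.transpose_smul, Matrix.transpose_smul, Matrix.add_mul,
        Matrix.smul_mul, Matrix.smul_mul, smul_add, smul_add, add_add_add_comm, ← add_smul, hst,
        one_smul]
    rwa [h1] at h
  refine convexHull_min ?_ hc hβ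
  rintro _ ⟨i, rfl⟩
  exact subset_convexHull ℝ _ ⟨i, rfl⟩

/-! ### Membership in the class and the form of `χ`. -/

namespace PWAModel

theorem gMap_eq (M : PWAModel p k L) (j : ℕ) {ℓ : Fin L} {z : Fin p → ℝ} (hz : z ∈ M.Z ℓ) :
    gMap M.f j z = M.gammaBar ℓ j + (M.Gamma ℓ j).mulVec z := by
  simp only [gMap, gammaBar, Gamma, M.f_eq _ hz, Finset.sum_add_distrib, Matrix.neg_mulVec,
    Matrix.sum_mulVec, neg_add]

theorem piMap_eq (M : PWAModel p k L) {ℓ : Fin L} {z : Fin p → ℝ} (hz : z ∈ M.Z ℓ) :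
    piMap M.f z = M.piBar ℓ + (M.Pi ℓ).mulVec z := by
  simp only [piMap, piBar, Pi, M.f_eq _ hz, Finset.sum_add_distrib, Matrix.neg_mulVec,
    Matrix.sub_mulVec, Matrix.sum_mulVec]
  abel

theorem continuous_piMap (M : PWAModel p k L) : Continuous (piMap M.f) :=
  (M.continuous_f 0).neg.add (continuous_finsetSum _ fun i _ => M.continuous_f i.succ)

theorem continuous_gMap (M : PWAModel p k L) (j : ℕ) : Continuous (gMap M.f j) :=
  (continuous_finsetSum _ fun i _ => M.continuous_f i).neg

/-- The closures of the images under `f₀` of the regions with nonsingular coefficient matrix cover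
`ℝ^p`. -/
theorem exists_mem_closure_image (M : PWAModel p k L) (hs : Function.Surjective (M.f 0))
    (y : Fin p → ℝ) : ∃ ℓ : {ℓ : Fin L // (M.Φ 0 ℓ).det ≠ 0}, y ∈ closure (M.f 0 '' M.Z ℓ) := by
  by_contra! hy
  let U : Set (Fin p → ℝ) := ⋂ ℓ : {ℓ : Fin L // (M.Φ 0 ℓ).det ≠ 0}, (closure (M.f 0 '' M.Z ℓ))ᶜ
  have hU : IsOpen U := isOpen_iInter_of_finite fun _ => isClosed_closure.isOpen_compl
  have hsub : U ⊆ ⋃ ℓ : {ℓ : Fin L // (M.Φ 0 ℓ).det = 0}, M.f 0 '' M.Z ℓ := by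
    intro x hx
    obtain ⟨z, rfl⟩ := hs x
    obtain ⟨ℓ, hℓ, -⟩ := M.partition z
    by_cases h : (M.Φ 0 ℓ).det = 0
    · exact Set.mem_iUnion.2 ⟨⟨ℓ, h⟩, z, hℓ, rfl⟩
    · exact absurd (subset_closure (Set.mem_image_of_mem (M.f 0) hℓ)) (Set.mem_iInter.1 hx ⟨ℓ, h⟩)
  -- A singular affine map sends any set to a null set, and a nonempty open `U` is not null.
  have hnull : MeasureTheory.volume
      (⋃ ℓ : {ℓ : Fin L // (M.Φ 0 ℓ).det = 0}, M.f 0 '' M.Z ℓ) = 0 := by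
    refine MeasureTheory.measure_iUnion_null fun ℓ => ?_
    have himg : M.f 0 '' M.Z ℓ =
        (fun x => -M.φ 0 ℓ + x) ⁻¹' ((Matrix.toLin' (M.Φ 0 ℓ)) '' M.Z ℓ) := by
      rw [← Set.image_add_left, Set.image_image]
      exact Set.image_congr fun z hz => M.f_eq 0 hz
    rw [himg, MeasureTheory.measure_preimage_add,
      MeasureTheory.Measure.addHaar_image_linearMap, LinearMap.det_toLin', ℓ.2]
    simp
  have hpos := hU.measure_pos MeasureTheory.volume ⟨y, Set.mem_iInter.2 hy⟩
  exact hpos.ne' (MeasureTheory.measure_mono_null hsub hnull)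

/-- The piecewise affine map `θ` with `π = α θ`. -/
def thetaMap (M : PWAModel p k L) (μbar : Fin L → Fin r → ℝ)
    (β : Fin L → Matrix (Fin p) (Fin r) ℝ) (z : Fin p → ℝ) : Fin r → ℝ :=
  ∑ ℓ, (M.Z ℓ).indicator (fun z => μbar ℓ + (β ℓ).transpose.mulVec z) z

theorem thetaMap_eq (M : PWAModel p k L) (μbar : Fin L → Fin r → ℝ)
    (β : Fin L → Matrix (Fin p) (Fin r) ℝ) {ℓ : Fin L} {z : Fin p → ℝ} (hz : z ∈ M.Z ℓ) :
    M.thetaMap μbar β z = μbar ℓ + (β ℓ).transpose.mulVec z :=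
  M.sum_indicator_eq (fun ℓ z => μbar ℓ + (β ℓ).transpose.mulVec z) hz

variable {M : PWAModel p k L} {α : Matrix (Fin p) (Fin r) ℝ} {μbar : Fin L → Fin r → ℝ}
  {β : Fin L → Matrix (Fin p) (Fin r) ℝ}

theorem piMap_eq_mulVec_thetaMap (hbar : ∀ ℓ, M.piBar ℓ = α.mulVec (μbar ℓ))
    (hPi : ∀ ℓ, M.Pi ℓ = α * (β ℓ).transpose) (z : Fin p → ℝ) :
    piMap M.f z = α.mulVec (M.thetaMap μbar β z) := by
  obtain ⟨ℓ, hz, -⟩ := M.partition z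
  rw [M.piMap_eq hz, M.thetaMap_eq _ _ hz, hbar, hPi, Matrix.mulVec_add, Matrix.mulVec_mulVec]

/-- An injective linear map in finite dimension is an embedding, so `θ` inherits continuity from `π
= α θ`. -/
theorem continuous_thetaMap (hα : α.rank = r) (hbar : ∀ ℓ, M.piBar ℓ = α.mulVec (μbar ℓ))
    (hPi : ∀ ℓ, M.Pi ℓ = α * (β ℓ).transpose) : Continuous (M.thetaMap μbar β) := by
  have hemb := LinearMap.isClosedEmbedding_of_injective (f := α.mulVecLin)
    (LinearMap.ker_eq_bot.2 (mulVec_injective_of_rank_eq hα))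
  rw [hemb.isInducing.continuous_iff]
  exact M.continuous_piMap.congr (piMap_eq_mulVec_thetaMap hbar hPi)

theorem boldTheta_thetaMap_sub {ℓ : Fin L} {z z' : Fin p → ℝ} (hz : z ∈ M.Z ℓ)
    (hz' : z' ∈ M.Z ℓ) :
    boldTheta M.f (M.thetaMap μbar β) z - boldTheta M.f (M.thetaMap μbar β) z'
      = (Matrix.fromRows (β ℓ).transpose (M.boldGamma ℓ)).mulVec (z - z') := by
  funext i
  rcases i with i | ⟨j, i⟩
  · simp only [Pi.sub_apply, boldTheta, Sum.elim_inl, M.thetaMap_eq _ _ hz,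
      M.thetaMap_eq _ _ hz', Matrix.fromRows_mulVec, Matrix.mulVec_sub, Pi.add_apply]
    ring
  · have h : (M.boldGamma ℓ).mulVec (z - z') (j, i)
        = (M.Gamma ℓ ((j : ℕ) + 1)).mulVec (z - z') i := rfl
    simp only [Pi.sub_apply, boldTheta, Sum.elim_inr, M.gMap_eq _ hz, M.gMap_eq _ hz',
      Matrix.fromRows_mulVec, h]
    simp only [Matrix.mulVec_sub, Pi.sub_apply, Pi.add_apply]
    ring

theorem boldTheta_comp_symm_sub {e : (Fin p → ℝ) ≃ₜ (Fin p → ℝ)} (he : ∀ z, e z = M.f 0 z)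
    (hθ : Continuous (M.thetaMap μbar β)) {ℓ : Fin L} (hdet : (M.Φ 0 ℓ).det ≠ 0) :
    ∀ y ∈ closure (M.f 0 '' M.Z ℓ), ∀ y' ∈ closure (M.f 0 '' M.Z ℓ),
      boldTheta M.f (M.thetaMap μbar β) (e.symm y) - boldTheta M.f (M.thetaMap μbar β) (e.symm y')
        = (Matrix.fromRows ((β ℓ).transpose * (M.Φ 0 ℓ)⁻¹)
            (M.boldGamma ℓ * (M.Φ 0 ℓ)⁻¹)).mulVec (y - y') := by
  have hcont : Continuous fun y => boldTheta M.f (M.thetaMap μbar β) (e.symm y) := by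
    refine continuous_pi fun i => ?_
    rcases i with i | ⟨j, i⟩
    · exact (continuous_apply i).comp (hθ.comp e.symm.continuous)
    · exact (continuous_apply i).comp ((M.continuous_gMap _).comp e.symm.continuous)
  refine increment_closure hcont (Matrix.mulVecLin _) ?_
  rintro _ ⟨z, hz, rfl⟩ _ ⟨z', hz', rfl⟩
  have hd : M.f 0 z - M.f 0 z' = (M.Φ 0 ℓ).mulVec (z - z') :=
    M.f_sub_closure 0 ℓ z (subset_closure hz) z' (subset_closure hz')
  rw [hd, ← he, ← he, e.symm_apply_apply, e.symm_apply_apply, boldTheta_thetaMap_sub hz hz',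
    Matrix.mulVecLin_apply, Matrix.mulVec_mulVec, Matrix.fromRows_mul, Matrix.mul_assoc,
    Matrix.mul_assoc, Matrix.nonsing_inv_mul _ (isUnit_iff_ne_zero.2 hdet), Matrix.mul_one,
    Matrix.mul_one]

theorem chiMap_eq (M : PWAModel p k L) {θ : (Fin p → ℝ) → (Fin r → ℝ)}
    (αp : Matrix (Fin p) (Fin (p - r)) ℝ) {ℓ : Fin L} {z : Fin p → ℝ} (hz : z ∈ M.Z ℓ)
    (hθ : θ z = μbar ℓ + (β ℓ).transpose.mulVec z) :
    chiMap αp M.f θ z = Sum.elim (αp.transpose.mulVec (M.psiBar ℓ)) (μbar ℓ)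
      + (Matrix.fromRows (αp.transpose * M.Psi ℓ) (β ℓ).transpose).mulVec z := by
  have h : M.f 0 z - ∑ j ∈ Finset.Icc 1 (k - 1), gMap M.f j z
      = M.psiBar ℓ + (M.Psi ℓ).mulVec z := by
    simp only [psiBar, Psi, M.f_eq 0 hz, M.gMap_eq _ hz, Finset.sum_add_distrib,
      Matrix.sub_mulVec, Matrix.sum_mulVec]
    abel
  rw [chiMap, h, hθ, Matrix.mulVec_add, Matrix.mulVec_mulVec, Matrix.fromRows_mulVec]
  funext i
  rcases i with i | i <;> rfl

theorem isHomeomorph_f_zero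
    (h : ((M.IsPiecewiseLinear ∨ M.IsThresholdAffine) ∧ M.SameDetSign) ∨
      IsHomeomorph (M.f 0)) : IsHomeomorph (M.f 0) := by
  rcases h with ⟨h | h, hs⟩ | h
  · exact h.isHomeomorph hs
  · exact h.isHomeomorph hs
  · exact h

/-- The linear map `β ↦ (x ↦ βᵀ x)`. -/
def transposeMulVec (m n : Type*) [Fintype m] [Fintype n] :
    Matrix m n ℝ →ₗ[ℝ] (m → ℝ) →ₗ[ℝ] (n → ℝ) :=
  (Matrix.mulVecBilin ℝ ℝ).comp (Matrix.transposeLinearEquiv m n ℝ ℝ).toLinearMap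

theorem isCVARWith {c : Fin p → ℝ} {b ρ : ℝ} {μ : Fin r → ℝ}
    (hρ0 : 0 ≤ ρ) (hρ1 : ρ < 1) (hf0 : IsHomeomorph (M.f 0))
    (hα : α.rank = r) (hc : c = α.mulVec μ) (hbar : ∀ ℓ, M.piBar ℓ = α.mulVec (μbar ℓ))
    (hPi : ∀ ℓ, M.Pi ℓ = α * (β ℓ).transpose)
    (hjsr : jsr (Set.range fun ℓ => 1 + (M.boldBeta β ℓ).transpose * boldAlpha k α)
      ≤ ENNReal.ofReal ρ)
    (hb : ∀ ℓ, matNorm (M.boldBeta β ℓ) ≤ b) :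
    IsCVARWith α b ρ c M.f μ (M.thetaMap μbar β) where
  rank_alpha := hα
  rho_nonneg := hρ0
  rho_lt_one := hρ1
  homeo := hf0
  const_eq := hc
  pi_eq := piMap_eq_mulVec_thetaMap hbar hPi
  gradient := by
    have hθ := continuous_thetaMap hα hbar hPi
    set e := hf0.homeomorph (M.f 0) with he_def
    have he : ∀ z, e z = M.f 0 z := fun _ => rfl
    refine ⟨convexHull ℝ (Set.range (M.boldBeta β)),
      ((Set.finite_range _).isCompact_convexHull ℝ).isClosed, ?_,
      (jsr_affine_convexHull_le _ _).trans hjsr, ?_⟩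
    · exact fun B hB => convexHull_min (Set.range_subset_iff.2 hb) (convex_matNorm_le b) hB
    · intro x x'
      have hG : Continuous fun x : Fin p ⊕ (Fin (k - 1) × Fin p) → ℝ =>
          boldTheta M.f (M.thetaMap μbar β) (e.symm (x ∘ Sum.inl)) + (matD0 p k r).mulVec x := by
        have hinl : Continuous fun x : Fin p ⊕ (Fin (k - 1) × Fin p) → ℝ => e.symm (x ∘ Sum.inl) :=
          e.symm.continuous.comp (by fun_prop)
        refine Continuous.add (continuous_pi fun i => ?_) (by fun_prop)
        rcases i with i | ⟨j, i⟩
        · exact (continuous_apply i).comp (hθ.comp hinl)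
        · exact (continuous_apply i).comp ((M.continuous_gMap _).comp hinl)
      -- Only nonsingular regimes index the cover, since the increment formula needs a true inverse
      -- of `Φ₀`; ℬ is the possibly larger hull over all regimes.
      obtain ⟨B, hB, h⟩ := exists_mem_convexHull_increment
        (transposeMulVec (Fin p ⊕ (Fin (k - 1) × Fin p)) (Fin r ⊕ (Fin (k - 1) × Fin p)))
        (fun ℓ : {ℓ : Fin L // (M.Φ 0 ℓ).det ≠ 0} => M.boldBeta β ℓ) hG
        (fun ℓ => {x | x ∘ Sum.inl ∈ closure (M.f 0 '' M.Z ℓ)})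
        (fun ℓ => isClosed_closure.preimage (by fun_prop))
        (fun x => M.exists_mem_closure_image hf0.surjective (x ∘ Sum.inl))
        (fun ℓ x hx y hy => by
          have h1 := boldTheta_comp_symm_sub he hθ ℓ.2 _ hx _ hy
          rw [add_sub_add_comm, h1, ← Matrix.mulVec_sub]
          change _ = (M.boldBeta β ℓ).transpose.mulVec (x - y)
          rw [boldBeta, Matrix.transpose_transpose, Matrix.fromBlocks_mulVec, matD0,
            Matrix.fromBlocks_mulVec, Matrix.fromRows_mulVec]
          funext i
          rcases i with i | i
          · simp [Pi.sub_comp]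
          · simp [Pi.sub_comp]) x x'
      have hsub : Set.range (fun ℓ : {ℓ : Fin L // (M.Φ 0 ℓ).det ≠ 0} => M.boldBeta β ℓ)
          ⊆ Set.range (M.boldBeta β) := by
        rintro _ ⟨ℓ, rfl⟩
        exact Set.mem_range_self ℓ.1
      exact ⟨B, convexHull_mono hsub hB, h⟩

end PWAModel

end NonlinearVAR

end

open NonlinearVAR in
theorem mainTheorem6 {p k r L : ℕ} (hk : 1 ≤ k) (M : PWAModel p k L)
    (c : Fin p → ℝ) (α : Matrix (Fin p) (Fin r) ℝ) (b ρ : ℝ)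
    (μ : Fin r → ℝ) (μbar : Fin L → (Fin r → ℝ)) (β : Fin L → Matrix (Fin p) (Fin r) ℝ)
    (hρ0 : 0 ≤ ρ) (hρ1 : ρ < 1)
    (hf0 : ((M.IsPiecewiseLinear ∨ M.IsThresholdAffine) ∧ M.SameDetSign) ∨
      IsHomeomorph (M.f 0))
    (hα : α.rank = r) (hβ : ∀ ℓ, (β ℓ).rank = r)
    (hc : c = α.mulVec μ) (hbar : ∀ ℓ, M.piBar ℓ = α.mulVec (μbar ℓ))
    (hPi : ∀ ℓ, M.Pi ℓ = α * (β ℓ).transpose)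
    (hjsr : jsr (Set.range fun ℓ => 1 + (M.boldBeta β ℓ).transpose * boldAlpha k α)
      ≤ ENNReal.ofReal ρ)
    (hb : ∀ ℓ, matNorm (M.boldBeta β ℓ) ≤ b) :
    InCVARClass α b ρ c M.f ∧
    ∀ θ : (Fin p → ℝ) → (Fin r → ℝ), (∀ z, piMap M.f z = α.mulVec (θ z)) →
      ∀ αp : Matrix (Fin p) (Fin (p - r)) ℝ, IsOrthCompl α αp →
        ∀ z, chiMap αp M.f θ z =
          ∑ ℓ, (M.Z ℓ).indicator (fun z =>
            Sum.elim (αp.transpose.mulVec (M.psiBar ℓ)) (μbar ℓ)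
              + (Matrix.fromRows (αp.transpose * M.Psi ℓ) (β ℓ).transpose).mulVec z) z := by
  have hθeq : ∀ θ : (Fin p → ℝ) → (Fin r → ℝ), (∀ z, piMap M.f z = α.mulVec (θ z)) →
      ∀ z, θ z = M.thetaMap μbar β z := fun θ hθ z =>
    mulVec_injective_of_rank_eq hα
      ((hθ z).symm.trans (PWAModel.piMap_eq_mulVec_thetaMap hbar hPi z))
  refine ⟨⟨μ, M.thetaMap μbar β, PWAModel.isCVARWith hρ0 hρ1 (PWAModel.isHomeomorph_f_zero hf0)
    hα hc hbar hPi hjsr hb⟩, fun θ hθ αp _ z => ?_⟩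
  obtain ⟨ℓ, hz, -⟩ := M.partition z
  rw [M.chiMap_eq αp hz ((hθeq θ hθ z).trans (M.thetaMap_eq μbar β hz))]
  exact (M.sum_indicator_eq (fun ℓ z => Sum.elim (αp.transpose.mulVec (M.psiBar ℓ)) (μbar ℓ)
    + (Matrix.fromRows (αp.transpose * M.Psi ℓ) (β ℓ).transpose).mulVec z) hz).symm
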